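/- Let $d\ge 1$ and $\hat f(\xi)=\int_{\mathbb{R}^d} f(x)e^{-2\pi i x\cdot\xi}\,dx$. **Classical spaces.** Let $\varphi,\Phi\in\mathcal S(\mathbb R^d)$ satisfy $\operatorname{supp}\hat\varphi\subseteq\{\frac12\le|\xi|\le 2\}$, $\operatorname{supp}\hat\Phi\subseteq\{|\xi|\le 2\}$ and, for some $c>0$, $|\hat\varphi(\xi)|\ge c$ if $\frac35\le|\xi|\le\frac53$ and $|\hat\Phi(\xi)|\ge c$ if $|\xi|\le\frac53$. Put $\varphi_{2^\nu I}(x)=2^{d\nu}\varphi(2^\nu x)$. For $\alpha\in\mathbb R$, $0<p<\infty$, $0<q\le\infty$, $\mathbf F^{\alpha,q}_p$ is the set of all $f\in\mathcal S'(\mathbb R^d)$ with $$\|f\|_{\mathbf F^{\alpha,q}_p}=\|\Phi*f\|_{L^p}+\Big\|\Big(\sum_{\nu=0}^\infty(2^{\nu\alpha}|\varphi_{2^\nu I}*f|)^q\Big)^{1/q}\Big\|_{L^p}<\infty$$ (with a supremum in place of the sum if $q=\infty$). **Shear anisotropic spaces.** Let $\hat\psi_1,\hat\psi_2\in C^\infty(\mathbb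 R)$ be complex-valued with $\operatorname{supp}\hat\psi_1\subseteq[-\frac12,-\frac1{16}]\cup[\frac1{16},\frac12]$, $\operatorname{supp}\hat\psi_2\subseteq[-1,1]$, $\sum_{j\ge0}|\hat\psi_1(2^{-2j}\omega)|^2=1$ for $|\omega|\ge\frac18$, and $|\hat\psi_2(\omega-1)|^2+|\hat\psi_2(\omega)|^2+|\hat\psi_2(\omega+1)|^2=1$ for $|\omega|\le1$. Let $\Psi\in\mathcal S(\mathbb R^d)$ with $\operatorname{supp}\hat\Psi\subseteq[-\frac14,\frac14]^d$ and $|\hat\Psi|=1$ on $[-\frac18,\frac18]^d$. For $i=1,\dots,d$ let $\psi^{(i)}\in\mathcal S(\mathbb R^d)$ be given by $\hat\psi^{(i)}(\xi)=\hat\psi_1(\xi_i)\prod_{k\ne i}\hat\psi_2(\xi_k/\xi_i)$ (and $0$ where $\xi_i=0$). Let $A_{(i)}$ be the diagonal $d\times d$ matrix with entry $4$ in position $i$ and $2$ elsewhere and, for $\ell=(\ell_k)_{k\ne i}\in\mathbb Z^{d-1}$, let $B^{[\ell]}_{(i)}$ be the identity matrix with the entries $\ell_k$, $k\neq i$, added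 to its $i$-th row. For $M\in GL_d(\mathbb R)$ put $\psi_M(x)=|\det M|^{-1}\psi(M^{-1}x)$, and $\tilde\psi(x)=\overline{\psi(-x)}$, $|Q_j|=2^{-(d+1)j}$. Then $\mathbf F^{\alpha,q}_p(AB)$ is the set of all $f\in\mathcal S'(\mathbb R^d)$ with $$\|f\|_{\mathbf F^{\alpha,q}_p(AB)}=\|f*\Psi\|_{L^p}+\Big\|\Big(\sum_{i=1}^d\sum_{j\ge0}\sum_{|\ell_k|\le2^j}\big[|Q_j|^{-\alpha}\,|\tilde\psi^{(i)}_{A_{(i)}^{-j}B_{(i)}^{[-\ell]}}*f|\big]^q\Big)^{1/q}\Big\|_{L^p}<\infty$$ (again with a supremum if $q=\infty$), the inner sum being over all $\ell\in\mathbb Z^{d-1}$ with $|\ell_k|\le 2^j$ for every $k\ne i$. **Theorem.** Let $\alpha_1,\alpha_2\in\mathbb R$, $0<q\le\infty$, $0<p<\infty$ and $\lambda>d\max(1,1/q,1/p)$ (with $1/\infty=0$). If $$(d+1)\alpha_2+\frac{d-1}{q}+\lambda\le 2\alpha_1,$$ then, for every choice of $\varphi,\Phi,\hat\psi_1,\hat\psi_2,\Psi$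 as above, $\mathbf F^{\alpha_1,q}_p\hookrightarrow\mathbf F^{\alpha_2,q}_p(AB)$: one has $\mathbf F^{\alpha_1,q}_p\subseteq\mathbf F^{\alpha_2,q}_p(AB)$, and there is a finite constant $C$ such that $\|f\|_{\mathbf F^{\alpha_2,q}_p(AB)}\le C\,\|f\|_{\mathbf F^{\alpha_1,q}_p}$ for all $f\in\mathbf F^{\alpha_1,q}_p$. -/

import Mathlib

open MeasureTheory
open scoped ENNReal NNReal SchwartzMap FourierTransform ContDiff

noncomputable section

namespace ShearTL

/-- `ℝ^d` with its Euclidean norm. -/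
abbrev E (d : ℕ) := EuclideanSpace ℝ (Fin d)

/-! ### Operations on test functions and distributions -/

/-- The linear automorphism `x ↦ M x` of `ℝ^d` (column vectors). -/
def actGL {d : ℕ} (M : GL (Fin d) ℝ) : E d ≃L[ℝ] E d :=
  ContinuousLinearEquiv.ofUnit
    (Units.map (Matrix.toEuclideanCLM (n := Fin d) (𝕜 := ℝ)).toMonoidHom M)

/-- The anisotropic dilation `ψ_M(x) = |det M|⁻¹ ψ(M⁻¹ x)`. -/
def dilate {d : ℕ} (M : GL (Fin d) ℝ) (ψ : 𝓢(E d, ℂ)) : 𝓢(E d, ℂ) :=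
  (|(M : Matrix (Fin d) (Fin d) ℝ).det|⁻¹ : ℝ) •
    SchwartzMap.compCLMOfContinuousLinearEquiv ℂ (actGL M⁻¹) ψ

/-- The reflection `x ↦ ψ(-x)`. -/
def reflect {d : ℕ} (ψ : 𝓢(E d, ℂ)) : 𝓢(E d, ℂ) :=
  SchwartzMap.compCLMOfContinuousLinearEquiv ℂ (ContinuousLinearEquiv.neg ℝ) ψ

/-- The involution `ψ̃(x) = conj (ψ(-x))`. -/
def tilde {d : ℕ} (ψ : 𝓢(E d, ℂ)) : 𝓢(E d, ℂ) :=
  (reflect ψ).postcompCLM (Complex.conjCLE : ℂ →L[ℝ] ℂ)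

/-- The convolution `(f * ψ)(x) = ⟨f, ψ(x - ·)⟩` of a tempered distribution with a Schwartz
function, as a function on `ℝ^d`. -/
def conv {d : ℕ} (f : 𝓢'(E d, ℂ)) (ψ : 𝓢(E d, ℂ)) (x : E d) : ℂ :=
  f (SchwartzMap.compSubConstCLM ℂ x (reflect ψ))

/-- The `ℓ^q` quasi-norm of a family of nonnegative extended reals, `0 < q ≤ ∞`. -/
def ellNorm {ι : Type*} (q : ℝ≥0∞) (a : ι → ℝ≥0∞) : ℝ≥0∞ :=
  if q = ⊤ then ⨆ i, a i else (∑' i, a i ^ q.toReal) ^ (1 / q.toReal)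

/-! ### Classical (dyadic isotropic) inhomogeneous Triebel–Lizorkin spaces -/

/-- Admissible pairs `(φ, Φ)` for the classical spaces. -/
structure IsDyadicPair {d : ℕ} (φ Φ : 𝓢(E d, ℂ)) : Prop where
  supp_phi : tsupport (𝓕 φ : 𝓢(E d, ℂ)) ⊆ {ξ | 1 / 2 ≤ ‖ξ‖ ∧ ‖ξ‖ ≤ 2}
  supp_Phi : tsupport (𝓕 Φ : 𝓢(E d, ℂ)) ⊆ {ξ | ‖ξ‖ ≤ 2}
  lower_phi : ∃ c : ℝ, 0 < c ∧ ∀ ξ : E d, 3 / 5 ≤ ‖ξ‖ → ‖ξ‖ ≤ 5 / 3 →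
    c ≤ ‖(𝓕 φ : 𝓢(E d, ℂ)) ξ‖
  lower_Phi : ∃ c : ℝ, 0 < c ∧ ∀ ξ : E d, ‖ξ‖ ≤ 5 / 3 → c ≤ ‖(𝓕 Φ : 𝓢(E d, ℂ)) ξ‖

/-- The dyadic dilation `φ_{2^ν I}(x) = 2^{dν} φ(2^ν x)`. -/
def dyadicDilate {d : ℕ} (ν : ℕ) (φ : 𝓢(E d, ℂ)) : 𝓢(E d, ℂ) :=
  ((2 : ℝ) ^ (d * ν)) •
    SchwartzMap.compCLMOfContinuousLinearEquiv ℂ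
      (ContinuousLinearEquiv.smulLeft (M₁ := E d) (R₁ := ℝ) (Units.mk0 (2 : ℝ) two_ne_zero ^ ν)) φ

/-- The quasi-norm of the classical space `F^{α,q}_p`. -/
def normF {d : ℕ} (φ Φ : 𝓢(E d, ℂ)) (α : ℝ) (q p : ℝ≥0∞) (f : 𝓢'(E d, ℂ)) : ℝ≥0∞ :=
  eLpNorm (conv f Φ) p volume +
    eLpNorm (fun x : E d => ellNorm q fun ν : ℕ =>
      ENNReal.ofReal ((2 : ℝ) ^ ((ν : ℝ) * α)) * ‖conv f (dyadicDilate ν φ) x‖ₑ) p volume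

/-- The classical inhomogeneous Triebel–Lizorkin space `F^{α,q}_p`. -/
def spaceF {d : ℕ} (φ Φ : 𝓢(E d, ℂ)) (α : ℝ) (q p : ℝ≥0∞) : Set 𝓢'(E d, ℂ) :=
  {f | normF φ Φ α q p f < ⊤}

/-! ### Shearlets on the cones -/

/-- The dilation matrix `A_{(i)}`: diagonal, `4` in position `i` and `2` elsewhere. -/
def A {d : ℕ} (i : Fin d) : GL (Fin d) ℝ :=
  Matrix.GeneralLinearGroup.mkOfDetNeZero (Matrix.diagonal fun k => if k = i then 4 else 2) (by
    rw [Matrix.det_diagonal, Finset.prod_ne_zero_iff]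
    intro k _
    split_ifs <;> norm_num)

/-- The off-diagonal part of the shear matrix: the entries `ℓ_k`, `k ≠ i`, in row `i`. -/
def shearPart {d : ℕ} (i : Fin d) (ℓ : {k : Fin d // k ≠ i} → ℤ) : Matrix (Fin d) (Fin d) ℝ :=
  Matrix.of fun a b => if h : b ≠ i then (if a = i then (ℓ ⟨b, h⟩ : ℝ) else 0) else 0

theorem shearPart_mul_self {d : ℕ} (i : Fin d) (ℓ : {k : Fin d // k ≠ i} → ℤ) :
    shearPart i ℓ * shearPart i ℓ = 0 := by
  ext a b
  rw [Matrix.mul_apply]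
  refine Finset.sum_eq_zero fun c _ => ?_
  by_cases hc : c = i <;> simp [shearPart, hc]

/-- The shear matrix `B_{(i)}^{[ℓ]}`. -/
def B {d : ℕ} (i : Fin d) (ℓ : {k : Fin d // k ≠ i} → ℤ) : GL (Fin d) ℝ where
  val := 1 + shearPart i ℓ
  inv := 1 - shearPart i ℓ
  val_inv := by
    have h := shearPart_mul_self i ℓ
    calc _ = 1 - shearPart i ℓ * shearPart i ℓ := by noncomm_ring
      _ = 1 := by rw [h, sub_zero]
  inv_val := by
    have h := shearPart_mul_self i ℓ
    calc _ = 1 - shearPart i ℓ * shearPart i ℓ := by noncomm_ring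
      _ = 1 := by rw [h, sub_zero]

/-- The generators of a system of shearlets on the cones. The functions `psi1Hat`, `psi2Hat` are the
one-dimensional profiles (in frequency), `Psi` is the low-frequency function. -/
structure Generators (d : ℕ) where
  psi1Hat : ℝ → ℂ
  psi2Hat : ℝ → ℂ
  Psi : 𝓢(E d, ℂ)
  smooth1 : ContDiff ℝ ∞ psi1Hat
  smooth2 : ContDiff ℝ ∞ psi2Hat
  supp1 : tsupport psi1Hat ⊆ Set.Icc (-(1 / 2)) (-(1 / 16)) ∪ Set.Icc (1 / 16) (1 / 2)
  supp2 : tsupport psi2Hat ⊆ Set.Icc (-1) 1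
  sum1 : ∀ w : ℝ, 1 / 8 ≤ |w| → HasSum (fun j : ℕ => ‖psi1Hat (w / 2 ^ (2 * j))‖ ^ 2) 1
  sum2 : ∀ w : ℝ, |w| ≤ 1 →
    ‖psi2Hat (w - 1)‖ ^ 2 + ‖psi2Hat w‖ ^ 2 + ‖psi2Hat (w + 1)‖ ^ 2 = 1
  supp_Psi : tsupport (𝓕 Psi : 𝓢(E d, ℂ)) ⊆ {ξ | ∀ k, |ξ k| ≤ 1 / 4}
  norm_Psi : ∀ ξ : E d, (∀ k, |ξ k| ≤ 1 / 8) → ‖(𝓕 Psi : 𝓢(E d, ℂ)) ξ‖ = 1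

namespace Generators

variable {d : ℕ} (G : Generators d)

/-- The Fourier transform of the shearlet `ψ^{(i)}`:
`ψ̂^{(i)}(ξ) = ψ̂₁(ξ_i) ∏_{k ≠ i} ψ̂₂(ξ_k / ξ_i)`. -/
def psiHat (i : Fin d) (ξ : E d) : ℂ :=
  G.psi1Hat (ξ i) * ∏ k ∈ Finset.univ.erase i, G.psi2Hat (ξ k / ξ i)

theorem psi1Hat_eq_zero {t : ℝ} (h : |t| < 1 / 16 ∨ 1 / 2 < |t|) : G.psi1Hat t = 0 := by
  by_contra hne
  have := G.supp1 (subset_tsupport _ hne)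
  rcases this with ⟨h1, h2⟩ | ⟨h1, h2⟩
  · rw [abs_of_nonpos (by linarith)] at h
    rcases h with h | h <;> linarith
  · rw [abs_of_nonneg (by linarith)] at h
    rcases h with h | h <;> linarith

theorem psi2Hat_eq_zero {t : ℝ} (h : 1 < |t|) : G.psi2Hat t = 0 := by
  by_contra hne
  have := G.supp2 (subset_tsupport _ hne)
  exact absurd (abs_le.mpr ⟨this.1, this.2⟩) (not_le.mpr h)

theorem contDiff_psiHat (i : Fin d) : ContDiff ℝ ∞ (G.psiHat i) := by
  have hc : ∀ k : Fin d, ContDiff ℝ ∞ fun ξ : E d => ξ k := fun k => by fun_prop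
  rw [contDiff_iff_contDiffAt]
  intro ξ
  by_cases h0 : ξ i = 0
  · have hev : G.psiHat i =ᶠ[nhds ξ] fun _ => 0 := by
      have : ∀ᶠ η : E d in nhds ξ, |η i| < 1 / 16 := by
        refine ((hc i).continuous.abs.tendsto ξ).eventually_lt_const ?_
        simp [h0]
      filter_upwards [this] with η hη
      simp [psiHat, G.psi1Hat_eq_zero (Or.inl hη)]
    exact contDiffAt_const.congr_of_eventuallyEq hev
  · unfold psiHat
    refine ContDiffAt.mul (G.smooth1.contDiffAt.comp ξ (hc i).contDiffAt) ?_
    refine contDiffAt_prod fun k _ => ?_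
    exact G.smooth2.contDiffAt.comp ξ ((hc k).contDiffAt.div (hc i).contDiffAt h0)

theorem hasCompactSupport_psiHat (i : Fin d) : HasCompactSupport (G.psiHat i) := by
  refine HasCompactSupport.of_support_subset_isCompact
    (isCompact_closedBall (0 : E d) (Real.sqrt (∑ _k : Fin d, (1 / 2) ^ 2))) ?_
  intro ξ hξ
  have h1 : |ξ i| ≤ 1 / 2 := by
    by_contra! h
    exact hξ (by simp [psiHat, G.psi1Hat_eq_zero (Or.inr h)])
  have h2 : ∀ k, |ξ k| ≤ 1 / 2 := by
    intro k
    by_cases hk : k = i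
    · rw [hk]; exact h1
    by_contra! h
    have hi : ξ i ≠ 0 := by
      intro h0
      exact hξ (by simp [psiHat, G.psi1Hat_eq_zero (t := ξ i) (Or.inl (by simp [h0]))])
    have : G.psi2Hat (ξ k / ξ i) = 0 := by
      apply G.psi2Hat_eq_zero
      rw [abs_div, lt_div_iff₀ (abs_pos.mpr hi)]
      linarith
    refine hξ ?_
    rw [psiHat, Finset.prod_eq_zero (Finset.mem_erase.mpr ⟨hk, Finset.mem_univ k⟩) this, mul_zero]
  rw [mem_closedBall_zero_iff, EuclideanSpace.norm_eq]
  refine Real.sqrt_le_sqrt (Finset.sum_le_sum fun k _ => ?_)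
  exact pow_le_pow_left₀ (norm_nonneg _) (h2 k) 2

/-- The shearlet `ψ^{(i)}` associated with the cone around the `ξ_i` axis. -/
def psi (i : Fin d) : 𝓢(E d, ℂ) :=
  𝓕⁻ ((G.hasCompactSupport_psiHat i).toSchwartzMap (G.contDiff_psiHat i))

end Generators

/-! ### Shear anisotropic inhomogeneous Triebel–Lizorkin spaces -/

/-- Indices `(i, j, ℓ)`: direction `i`, scale `j ≥ 0`, shear `ℓ ∈ ℤ^{d-1}` with `|ℓ_k| ≤ 2^j`. -/
abbrev ShearIndex (d : ℕ) : Type :=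
  Σ i : Fin d, Σ j : ℕ, {ℓ : {k : Fin d // k ≠ i} → ℤ // ∀ k, |ℓ k| ≤ 2 ^ j}

/-- The measure `|Q_j| = |det A|^{-j} = 2^{-(d+1)j}` of the parallelepipeds of scale `j`. -/
def cellVolume (d j : ℕ) : ℝ := ((2 : ℝ) ^ ((d + 1) * j))⁻¹

/-- The quasi-norm of `F^{α,q}_p(AB)`. -/
def normFAB {d : ℕ} (G : Generators d) (α : ℝ) (q p : ℝ≥0∞) (f : 𝓢'(E d, ℂ)) : ℝ≥0∞ :=
  eLpNorm (conv f G.Psi) p volume +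
    eLpNorm (fun x : E d => ellNorm q fun s : ShearIndex d =>
      ENNReal.ofReal (cellVolume d s.2.1 ^ (-α)) *
        ‖conv f (dilate ((A s.1 ^ s.2.1)⁻¹ * (B s.1 s.2.2.1)⁻¹) (tilde (G.psi s.1))) x‖ₑ) p volume

/-- The shear anisotropic inhomogeneous Triebel–Lizorkin space `F^{α,q}_p(AB)`. -/
def spaceFAB {d : ℕ} (G : Generators d) (α : ℝ) (q p : ℝ≥0∞) : Set 𝓢'(E d, ℂ) :=
  {f | normFAB G α q p f < ⊤}

end ShearTL

end

open MeasureTheory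
open scoped ENNReal NNReal SchwartzMap FourierTransform ContDiff

noncomputable section

namespace ShearTL

/-! In frequency, a shearlet of scale j lies in the isotropic annulus 4^j/16 ≤ |ξ| ≤ d·4^j, whatever
its direction and shear (`fourier_shearlet_support`). A bounded number of dyadic blocks φ_ν, with ν
= 2j + O(1), covers this annulus. A Calderón-type formula (`exists_reproducing`) therefore writes
the shearlet ψ_s as a finite sum of ψ_s * ρ * φ_ν, and f * ψ_s is controlled by the blocks f * φ_ν.

Replacing each block by a majorant of its Peetre maximal function gives |f * ψ_s(x)| ≤ m_s V_j(x),
where m_s is the integral of |ψ_s(y)| (1 + 4^j|y|)^a. For a > d / min(1, p) the p-th power of the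
L^p norm of V_j is bounded by the sum of those of the blocks (`exists_peetre_majorant`,
`exists_majorant`). The shearlet is elongated: its longest side is about 2^{-j}, not 4^{-j}, so m_s
= O(2^{ja}) (`exists_moment_shearlet_le`).

The rest is counting powers of 2^j. The weight |Q_j|^{-α₂} costs (d+1)α₂, the roughly 2^{j(d-1)}
shears cost (d-1)/q in the ℓ^q norm, the moment costs a, and the blocks gain 2α₁. Since λ > d max(1,
1/p), some a < λ is admissible, and the hypothesis leaves a spare factor 2^{-j(λ-a)}. Half of it
makes the ℓ^q sum over scales converge, the other half the sum of p-th powers of L^p norms. Thus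
only the individual bounds on 2^{να₁}‖f * φ_ν‖_p are needed, and no vector-valued maximal inequality
enters.

Distributions require one preliminary, f * (a * b) = a * (f * b) (`conv_sconv`), which is obtained
by extending f to a Banach space of jets. -/

/-! ### Translations of Schwartz functions -/

section Translation

variable {d : ℕ}

/-- The translate `z ↦ ρ (z - y)`. -/
abbrev translate (y : E d) (ρ : 𝓢(E d, ℂ)) : 𝓢(E d, ℂ) := SchwartzMap.compSubConstCLM ℂ y ρ

theorem iteratedFDeriv_translate (y : E d) (ρ : 𝓢(E d, ℂ)) (n : ℕ) (x : E d) :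
    iteratedFDeriv ℝ n (translate y ρ) x = iteratedFDeriv ℝ n ρ (x - y) := by
  have : (translate y ρ : E d → ℂ) = fun z => ρ (z - y) := by
    ext z; rfl
  rw [this, iteratedFDeriv_comp_sub]

/-- The point `w` is kept free so that one bound serves both for w = x - y and for all points of a
segment between two translates, as the mean value inequality requires. -/
theorem exists_weighted_iteratedFDeriv_le (ρ : 𝓢(E d, ℂ)) (k n : ℕ) :
    ∃ C : ℝ, 0 ≤ C ∧ ∀ (x w : E d) (s : ℝ), 0 ≤ s → ‖x‖ ≤ ‖w‖ + s →
      ‖x‖ ^ k * ‖iteratedFDeriv ℝ n ρ w‖ ≤ C * (1 + s) ^ k := by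
  refine ⟨2 ^ k * ((Finset.Iic (k, n)).sup fun m => SchwartzMap.seminorm ℝ m.1 m.2) ρ,
    by positivity, fun x w s hs hx => ?_⟩
  have h1 := SchwartzMap.one_add_le_sup_seminorm_apply (𝕜 := ℝ) (m := (k, n)) le_rfl le_rfl ρ w
  have h2 : ‖x‖ ^ k ≤ (1 + ‖w‖) ^ k * (1 + s) ^ k := by
    rw [← mul_pow]
    refine pow_le_pow_left₀ (norm_nonneg _) ?_ k
    nlinarith [norm_nonneg w, mul_nonneg (norm_nonneg w) hs]
  calc ‖x‖ ^ k * ‖iteratedFDeriv ℝ n ρ w‖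
      ≤ ((1 + ‖w‖) ^ k * (1 + s) ^ k) * ‖iteratedFDeriv ℝ n ρ w‖ := by gcongr
    _ = ((1 + ‖w‖) ^ k * ‖iteratedFDeriv ℝ n ρ w‖) * (1 + s) ^ k := by ring
    _ ≤ _ := by gcongr

theorem exists_seminorm_translate_le (ρ : 𝓢(E d, ℂ)) (k n : ℕ) :
    ∃ C : ℝ, 0 ≤ C ∧ ∀ y : E d,
      SchwartzMap.seminorm ℂ k n (translate y ρ) ≤ C * (1 + ‖y‖) ^ k := by
  obtain ⟨C, hC, h⟩ := exists_weighted_iteratedFDeriv_le ρ k n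
  refine ⟨C, hC, fun y => SchwartzMap.seminorm_le_bound ℂ k n _ (by positivity) fun x => ?_⟩
  rw [iteratedFDeriv_translate]
  refine h x (x - y) ‖y‖ (norm_nonneg _) ?_
  calc ‖x‖ = ‖(x - y) + y‖ := by rw [sub_add_cancel]
    _ ≤ _ := norm_add_le _ _

/-- Mean value inequality along the segment from x - y' to x - y, at the cost of one more
derivative. -/
theorem exists_seminorm_translate_sub_le (ρ : 𝓢(E d, ℂ)) (k n : ℕ) :
    ∃ C : ℝ, 0 ≤ C ∧ ∀ y y' : E d,
      SchwartzMap.seminorm ℂ k n (translate y ρ - translate y' ρ) ≤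
        C * (1 + (‖y‖ + ‖y'‖)) ^ k * ‖y - y'‖ := by
  obtain ⟨C, hC, h⟩ := exists_weighted_iteratedFDeriv_le ρ k (n + 1)
  refine ⟨C, hC, fun y y' => SchwartzMap.seminorm_le_bound ℂ k n _ (by positivity) fun x => ?_⟩
  have hsub : iteratedFDeriv ℝ n (translate y ρ - translate y' ρ : 𝓢(E d, ℂ)) x =
      iteratedFDeriv ℝ n ρ (x - y) - iteratedFDeriv ℝ n ρ (x - y') := by
    have : ((translate y ρ - translate y' ρ : 𝓢(E d, ℂ)) : E d → ℂ) =
      (translate y ρ : E d → ℂ) - (translate y' ρ : E d → ℂ) := rfl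
    rw [this, iteratedFDeriv_sub_apply (SchwartzMap.contDiffAt _ n) (SchwartzMap.contDiffAt _ n),
      iteratedFDeriv_translate, iteratedFDeriv_translate]
  rw [hsub]
  have hdiff : ∀ w, DifferentiableAt ℝ (iteratedFDeriv ℝ n ρ) w := fun w =>
    ((ρ.smooth ⊤).differentiable_iteratedFDeriv (mod_cast ENat.natCast_lt_top n)) w
  have key := (convex_segment (x - y') (x - y)).norm_image_sub_le_of_norm_fderiv_le
    (𝕜 := ℝ) (f := fun w => (‖x‖ ^ k) • iteratedFDeriv ℝ n ρ w)
    (C := C * (1 + (‖y‖ + ‖y'‖)) ^ k) (fun w _ => (hdiff w).const_smul (‖x‖ ^ k)) ?_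
    (left_mem_segment ℝ _ _) (right_mem_segment ℝ _ _)
  · rw [← smul_sub, norm_smul, Real.norm_of_nonneg (by positivity)] at key
    refine key.trans (le_of_eq ?_)
    rw [show x - y - (x - y') = -(y - y') by abel, norm_neg]
  · intro w hw
    rw [fderiv_fun_const_smul (hdiff w), norm_smul, Real.norm_of_nonneg (by positivity),
      norm_fderiv_iteratedFDeriv]
    refine h x w _ (by positivity) ?_
    obtain ⟨a, b, ha, hb, hab, rfl⟩ := hw
    have e : x = (a • (x - y') + b • (x - y)) + (a • y' + b • y) := by
      rw [smul_sub, smul_sub]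
      have : a • x + b • x = x := by rw [← add_smul, hab, one_smul]
      nth_rw 1 [← this]; abel
    have h3 : ‖a • y' + b • y‖ ≤ ‖y‖ + ‖y'‖ := by
      refine (norm_add_le _ _).trans ?_
      rw [norm_smul, norm_smul, Real.norm_of_nonneg ha, Real.norm_of_nonneg hb]
      nlinarith [norm_nonneg y, norm_nonneg y']
    calc ‖x‖ = ‖(a • (x - y') + b • (x - y)) + (a • y' + b • y)‖ := by rw [← e]
      _ ≤ _ := (norm_add_le _ _).trans (by gcongr)

theorem continuous_translate (ρ : 𝓢(E d, ℂ)) : Continuous fun y : E d => translate y ρ := by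
  rw [continuous_iff_continuousAt]
  intro y'
  rw [ContinuousAt, (schwartz_withSeminorms ℂ (E d) ℂ).tendsto_nhds _ _]
  rintro ⟨k, n⟩ ε hε
  obtain ⟨C, hC, h⟩ := exists_seminorm_translate_sub_le ρ k n
  have hlim : Filter.Tendsto (fun y : E d => C * (1 + (‖y‖ + ‖y'‖)) ^ k * ‖y - y'‖)
      (nhds y') (nhds 0) := by
    have : Continuous fun y : E d => C * (1 + (‖y‖ + ‖y'‖)) ^ k * ‖y - y'‖ := by fun_prop
    simpa using this.tendsto y'
  filter_upwards [hlim.eventually_lt_const hε] with y hy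
  exact (h y y').trans_lt hy

end Translation

/-! ### Tempered distributions extend to a Banach space -/

section Embedding

variable {d : ℕ}

open scoped BoundedContinuousFunction

/-- The weighted `n`-th derivative of a Schwartz function, as a bounded continuous function. -/
def weightedDeriv (k n : ℕ) : 𝓢(E d, ℂ) →L[ℂ] (E d →ᵇ (E d [×n]→L[ℝ] ℂ)) :=
  SchwartzMap.mkCLMtoNormedSpace
    (fun h => BoundedContinuousFunction.ofNormedAddCommGroup
      (fun x => (‖x‖ ^ k) • iteratedFDeriv ℝ n h x)
      ((continuous_norm.pow k).smul ((h.smooth ⊤).continuous_iteratedFDeriv (mod_cast le_top)))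
      (SchwartzMap.seminorm ℂ k n h) fun x => by
        rw [norm_smul, Real.norm_of_nonneg (by positivity)]
        exact SchwartzMap.le_seminorm ℂ k n h x)
    (fun f g => by
      ext1 x
      change (‖x‖ ^ k) • iteratedFDeriv ℝ n ((f : E d → ℂ) + (g : E d → ℂ)) x = _
      rw [iteratedFDeriv_add_apply (f.contDiffAt n) (g.contDiffAt n), smul_add]
      rfl)
    (fun a f => by
      ext1 x
      change (‖x‖ ^ k) • iteratedFDeriv ℝ n (a • (f : E d → ℂ)) x =
        a • ((‖x‖ ^ k) • iteratedFDeriv ℝ n f x)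
      rw [iteratedFDeriv_const_smul_apply (f.contDiffAt n), smul_comm])
    ⟨{(k, n)}, 1, zero_le_one, fun h => by
      rw [one_mul, Finset.sup_singleton]
      exact BoundedContinuousFunction.norm_ofNormedAddCommGroup_le _ (apply_nonneg _ _) _⟩

theorem weightedDeriv_apply (k n : ℕ) (h : 𝓢(E d, ℂ)) (x : E d) :
    weightedDeriv k n h x = (‖x‖ ^ k) • iteratedFDeriv ℝ n h x := rfl

theorem seminorm_le_norm_weightedDeriv (k n : ℕ) (h : 𝓢(E d, ℂ)) :
    SchwartzMap.seminorm ℂ k n h ≤ ‖weightedDeriv k n h‖ := by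
  refine SchwartzMap.seminorm_le_bound ℂ k n _ (norm_nonneg (weightedDeriv k n h)) fun x => ?_
  have := (weightedDeriv k n h).norm_coe_le_norm x
  rwa [weightedDeriv_apply, norm_smul, Real.norm_of_nonneg (by positivity)] at this

/-- The Banach space of finite families of bounded continuous multilinear-valued functions. -/
def JetSpace (d : ℕ) (s : Finset (ℕ × ℕ)) : Type :=
  (i : s) → (E d →ᵇ (E d [×i.1.2]→L[ℝ] ℂ))

instance (s : Finset (ℕ × ℕ)) : NormedAddCommGroup (JetSpace d s) :=
  inferInstanceAs (NormedAddCommGroup ((i : s) → (E d →ᵇ (E d [×i.1.2]→L[ℝ] ℂ))))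

instance (s : Finset (ℕ × ℕ)) : NormedSpace ℂ (JetSpace d s) :=
  inferInstanceAs (NormedSpace ℂ ((i : s) → (E d →ᵇ (E d [×i.1.2]→L[ℝ] ℂ))))

instance (s : Finset (ℕ × ℕ)) : CompleteSpace (JetSpace d s) :=
  inferInstanceAs (CompleteSpace ((i : s) → (E d →ᵇ (E d [×i.1.2]→L[ℝ] ℂ))))

/-- Finitely many weighted derivatives of a Schwartz function. -/
def weightedJet (s : Finset (ℕ × ℕ)) : 𝓢(E d, ℂ) →L[ℂ] JetSpace d s :=
  ContinuousLinearMap.pi (φ := fun i : s => (E d →ᵇ (E d [×i.1.2]→L[ℝ] ℂ)))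
    fun i => weightedDeriv i.1.1 i.1.2

/-- Evaluation of one component of a jet, as a continuous linear functional. -/
def JetSpace.eval (s : Finset (ℕ × ℕ)) (i : s) (x : E d) (m : Fin i.1.2 → E d) :
    StrongDual ℂ (JetSpace d s) :=
  LinearMap.mkContinuous
    { toFun := fun a => (show E d →ᵇ (E d [×i.1.2]→L[ℝ] ℂ) from a i) x m
      map_add' := fun _ _ => rfl
      map_smul' := fun _ _ => rfl } (∏ j, ‖m j‖) fun a => by
    let b : (i : s) → (E d →ᵇ (E d [×i.1.2]→L[ℝ] ℂ)) := a
    calc ‖b i x m‖ ≤ ‖b i x‖ * ∏ j, ‖m j‖ := (b i x).le_opNorm m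
      _ ≤ ‖b‖ * ∏ j, ‖m j‖ := by
        gcongr
        exact ((b i).norm_coe_le_norm x).trans (norm_le_pi_norm b i)
      _ = (∏ j, ‖m j‖) * ‖b‖ := mul_comm _ _

theorem JetSpace.ext_eval {s : Finset (ℕ × ℕ)} {a b : JetSpace d s}
    (h : ∀ i x m, JetSpace.eval s i x m a = JetSpace.eval s i x m b) : a = b := by
  refine funext fun i => BoundedContinuousFunction.ext fun x => ContinuousMultilinearMap.ext fun m => ?_
  exact h i x m

theorem JetSpace.eval_weightedJet (s : Finset (ℕ × ℕ)) (h : 𝓢(E d, ℂ)) (i : s) (x : E d)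
    (m : Fin i.1.2 → E d) : JetSpace.eval s i x m (weightedJet s h) =
      (‖x‖ ^ i.1.1) • iteratedFDeriv ℝ i.1.2 h x m := rfl

theorem norm_weightedDeriv_le_norm_weightedJet (s : Finset (ℕ × ℕ)) (h : 𝓢(E d, ℂ)) (i : s) :
    ‖weightedDeriv i.1.1 i.1.2 h‖ ≤ ‖weightedJet s h‖ :=
  norm_le_pi_norm (fun i : s => weightedDeriv i.1.1 i.1.2 h) i

/-- The bound forces f to vanish on ker J, so f descends to a bounded functional on range J, which
Hahn–Banach extends to Y. -/
theorem exists_strongDual_factor {X Y : Type*} [AddCommGroup X] [Module ℂ X]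
    [NormedAddCommGroup Y] [NormedSpace ℂ Y] (J : X →ₗ[ℂ] Y) (f : X →ₗ[ℂ] ℂ) (C : ℝ)
    (hle : ∀ h, ‖f h‖ ≤ C * ‖J h‖) : ∃ F : StrongDual ℂ Y, ∀ h, f h = F (J h) := by
  have hker : LinearMap.ker J ≤ LinearMap.ker f := by
    intro h hh
    have := hle h
    rw [LinearMap.mem_ker.mp hh, norm_zero, mul_zero] at this
    exact norm_le_zero_iff.mp this
  obtain ⟨g, hg⟩ : ∃ g : LinearMap.range J →ₗ[ℂ] ℂ, ∀ h, g ⟨J h, h, rfl⟩ = f h := by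
    refine ⟨(LinearMap.ker J).liftQ f hker ∘ₗ J.quotKerEquivRange.symm.toLinearMap,
      fun h => ?_⟩
    have : J.quotKerEquivRange.symm ⟨J h, h, rfl⟩ = (LinearMap.ker J).mkQ h := by
      rw [LinearEquiv.symm_apply_eq]; rfl
    simp only [LinearMap.comp_apply, LinearEquiv.coe_coe, this]
    rfl
  let g' := g.mkContinuous C (by
    rintro ⟨_, h, rfl⟩
    rw [hg]
    exact hle h)
  obtain ⟨F, hF, -⟩ := exists_extension_norm_eq _ g'
  refine ⟨F, fun h => ?_⟩
  rw [← hg h]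
  exact (hF ⟨J h, h, rfl⟩).symm

/-- Continuity bounds f by finitely many Schwartz seminorms, all read off from one jet. Since the
jets form a Banach space, Bochner integrals can then be moved through f. -/
theorem exists_factor_weightedJet (f : 𝓢'(E d, ℂ)) :
    ∃ (s : Finset (ℕ × ℕ)) (F : StrongDual ℂ (JetSpace d s)), ∀ h, f h = F (weightedJet s h) := by
  have hcont : Continuous fun h : 𝓢(E d, ℂ) => f h := f.continuous
  obtain ⟨s, C, hC, hbound⟩ := Seminorm.bound_of_continuous (schwartz_withSeminorms ℂ (E d) ℂ)
    ((normSeminorm ℂ ℂ).comp f.toLinearMap) (continuous_norm.comp hcont)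
  have hle : ∀ h, ‖f h‖ ≤ C * ‖weightedJet s h‖ := by
    intro h
    refine (hbound h).trans ?_
    rw [smul_apply, NNReal.smul_def, smul_eq_mul]
    refine mul_le_mul_of_nonneg_left ?_ C.2
    refine Seminorm.finset_sup_apply_le (norm_nonneg (weightedJet s h)) fun i hi => ?_
    exact (seminorm_le_norm_weightedDeriv i.1 i.2 h).trans
      (norm_weightedDeriv_le_norm_weightedJet s h ⟨i, hi⟩)
  obtain ⟨F, hF⟩ := exists_strongDual_factor (weightedJet (d := d) s).toLinearMap f.toLinearMap C
    fun h => hle h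
  exact ⟨s, F, hF⟩

end Embedding

/-! ### Convolution of a tempered distribution with a convolution of Schwartz functions -/

section Exchange

variable {d : ℕ}

open LineDeriv SchwartzMap

/-- The convolution of two Schwartz functions. -/
abbrev sconv (a b : 𝓢(E d, ℂ)) : 𝓢(E d, ℂ) := SchwartzMap.convolution (ContinuousLinearMap.mul ℂ ℂ) a b

theorem sconv_apply (a b : 𝓢(E d, ℂ)) (x : E d) : sconv a b x = ∫ t, a t * b (x - t) :=
  SchwartzMap.convolution_apply _ a b x

theorem fourier_sconv_apply (a b : 𝓢(E d, ℂ)) (ξ : E d) :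
    𝓕 (sconv a b) ξ = 𝓕 a ξ * 𝓕 b ξ := by
  rw [sconv, SchwartzMap.fourier_convolution]; rfl

theorem fourier_injective {a b : 𝓢(E d, ℂ)} (h : ∀ ξ, 𝓕 a ξ = 𝓕 b ξ) : a = b := by
  have : (𝓕 a : 𝓢(E d, ℂ)) = 𝓕 b := SchwartzMap.ext h
  simpa using congrArg (fun c : 𝓢(E d, ℂ) => (𝓕⁻ c : 𝓢(E d, ℂ))) this

/-- In frequency a derivative is a scalar multiplier, which may be attached to either factor of the
product. -/
theorem lineDeriv_sconv (a b : 𝓢(E d, ℂ)) (m : E d) : ∂_{m} (sconv a b) = sconv a (∂_{m} b) := by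
  refine fourier_injective fun ξ => ?_
  have ht : (inner ℝ · m : E d → ℝ).HasTemperateGrowth := by fun_prop
  rw [fourier_sconv_apply, fourier_lineDerivOp_eq, fourier_lineDerivOp_eq]
  simp only [smul_apply, smulLeftCLM_apply_apply ht]
  rw [fourier_sconv_apply]
  simp only [smul_eq_mul, Complex.real_smul]
  ring

theorem iteratedLineDeriv_sconv (a b : 𝓢(E d, ℂ)) {n : ℕ} (m : Fin n → E d) :
    ∂^{m} (sconv a b) = sconv a (∂^{m} b) := by
  induction n with
  | zero => simp
  | succ n ih => rw [iteratedLineDerivOp_succ_left, ih, lineDeriv_sconv, iteratedLineDerivOp_succ_left]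

theorem iteratedFDeriv_sconv_apply (a b : 𝓢(E d, ℂ)) {n : ℕ} (m : Fin n → E d) (x : E d) :
    iteratedFDeriv ℝ n (sconv a b) x m = ∫ t, a t * iteratedFDeriv ℝ n b (x - t) m := by
  rw [← iteratedLineDerivOp_eq_iteratedFDeriv, iteratedLineDeriv_sconv, sconv_apply]
  simp only [iteratedLineDerivOp_eq_iteratedFDeriv]

theorem norm_weightedDeriv_le (k n : ℕ) (h : 𝓢(E d, ℂ)) :
    ‖weightedDeriv k n h‖ ≤ SchwartzMap.seminorm ℂ k n h := by
  refine (BoundedContinuousFunction.norm_le (apply_nonneg _ _)).2 fun x => ?_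
  rw [weightedDeriv_apply, norm_smul, Real.norm_of_nonneg (by positivity)]
  exact SchwartzMap.le_seminorm ℂ k n h x

theorem exists_norm_weightedJet_translate_le (s : Finset (ℕ × ℕ)) (b : 𝓢(E d, ℂ)) :
    ∃ C : ℝ, 0 ≤ C ∧ ∃ k : ℕ, ∀ t, ‖weightedJet s (translate t b)‖ ≤ C * (1 + ‖t‖) ^ k := by
  choose C hC h using fun i : ℕ × ℕ => exists_seminorm_translate_le b i.1 i.2
  refine ⟨∑ i ∈ s, C i, Finset.sum_nonneg fun i _ => hC i, s.sup Prod.fst, fun t => ?_⟩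
  have hnn : 0 ≤ (∑ i ∈ s, C i) * (1 + ‖t‖) ^ s.sup Prod.fst :=
    mul_nonneg (Finset.sum_nonneg fun i _ => hC i) (by positivity)
  refine (pi_norm_le_iff_of_nonneg (x := fun i : s => weightedDeriv i.1.1 i.1.2 (translate t b))
    hnn).2 fun i => ?_
  calc ‖weightedDeriv i.1.1 i.1.2 (translate t b)‖
      ≤ SchwartzMap.seminorm ℂ i.1.1 i.1.2 (translate t b) := norm_weightedDeriv_le _ _ _
    _ ≤ C i.1 * (1 + ‖t‖) ^ i.1.1 := h i.1 t
    _ ≤ (∑ i ∈ s, C i) * (1 + ‖t‖) ^ s.sup Prod.fst := by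
        gcongr
        · exact Finset.sum_nonneg fun i _ => hC i
        · exact Finset.single_le_sum (fun i _ => hC i) i.2
        · linarith [norm_nonneg t]
        · exact Finset.le_sup (f := Prod.fst) i.2

theorem integrable_one_add_norm_pow_mul (a : 𝓢(E d, ℂ)) (k : ℕ) :
    Integrable fun t => (1 + ‖t‖) ^ k * ‖a t‖ := by
  have : ∀ t : E d, (1 + ‖t‖) ^ k * ‖a t‖ =
      ∑ i ∈ Finset.range (k + 1), (k.choose i : ℝ) * (‖t‖ ^ i * ‖a t‖) := by
    intro t
    rw [add_comm, add_pow, Finset.sum_mul]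
    refine Finset.sum_congr rfl fun i _ => ?_
    rw [one_pow]; ring
  simp_rw [this]
  exact integrable_finsetSum _ fun i _ => (a.integrable_pow_mul volume i).const_mul _

/-- The convolution a * b is the superposition of the translates of b with density a. As an identity
of Bochner integrals of jets it is checked on the evaluations `JetSpace.eval`, which separate
points. Integrability is the polynomial growth of the translates against the decay of a. -/
theorem apply_sconv (f : 𝓢'(E d, ℂ)) (a b : 𝓢(E d, ℂ)) :
    f (sconv a b) = ∫ t, a t * f (translate t b) := by
  obtain ⟨s, F, hF⟩ := exists_factor_weightedJet f
  obtain ⟨C, hC, k, hle⟩ := exists_norm_weightedJet_translate_le s b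
  have hcont : Continuous fun t => a t • weightedJet s (translate t b) :=
    a.continuous.smul ((weightedJet s).continuous.comp (continuous_translate b))
  have hint : Integrable fun t => a t • weightedJet s (translate t b) := by
    refine ((integrable_one_add_norm_pow_mul a k).const_mul C).mono' hcont.aestronglyMeasurable
      (Filter.Eventually.of_forall fun t => ?_)
    rw [norm_smul]
    calc ‖a t‖ * ‖weightedJet s (translate t b)‖ ≤ ‖a t‖ * (C * (1 + ‖t‖) ^ k) := by
          gcongr; exact hle t
      _ = _ := by ring
  have hI : ∫ t, a t • weightedJet s (translate t b) = weightedJet s (sconv a b) := by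
    refine JetSpace.ext_eval fun i x m => ?_
    rw [← ContinuousLinearMap.integral_comp_comm _ hint, JetSpace.eval_weightedJet,
      iteratedFDeriv_sconv_apply, Complex.real_smul, ← integral_const_mul]
    refine integral_congr_ae (Filter.Eventually.of_forall fun t => ?_)
    simp only [map_smul, JetSpace.eval_weightedJet, iteratedFDeriv_translate, Complex.real_smul,
      smul_eq_mul]
    ring
  rw [hF, ← hI, ← ContinuousLinearMap.integral_comp_comm _ hint]
  simp only [map_smul, smul_eq_mul, hF]

theorem translate_translate (x y : E d) (b : 𝓢(E d, ℂ)) :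
    translate x (translate y b) = translate (x + y) b := by
  ext z
  change b (z - x - y) = b (z - (x + y))
  rw [sub_sub]

theorem translate_sconv (x : E d) (a b : 𝓢(E d, ℂ)) :
    translate x (sconv a b) = sconv a (translate x b) := by
  ext z
  change sconv a b (z - x) = _
  rw [sconv_apply, sconv_apply]
  refine integral_congr_ae (Filter.Eventually.of_forall fun t => ?_)
  change a t * b (z - x - t) = a t * b (z - t - x)
  rw [sub_right_comm]

theorem reflect_apply (a : 𝓢(E d, ℂ)) (x : E d) : reflect a x = a (-x) := rfl

theorem reflect_sconv (a b : 𝓢(E d, ℂ)) : reflect (sconv a b) = sconv (reflect a) (reflect b) := by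
  ext z
  rw [reflect_apply, sconv_apply, sconv_apply,
    ← integral_neg_eq_self (fun t => a t * b (-z - t)) volume]
  refine integral_congr_ae (Filter.Eventually.of_forall fun t => ?_)
  simp only [reflect_apply]
  congr 2
  abel

theorem conv_eq (f : 𝓢'(E d, ℂ)) (ψ : 𝓢(E d, ℂ)) (x : E d) :
    conv f ψ x = f (translate x (reflect ψ)) := rfl

/-- `f * (a * b) = a * (f * b)`. -/
theorem conv_sconv (f : 𝓢'(E d, ℂ)) (a b : 𝓢(E d, ℂ)) (x : E d) :
    conv f (sconv a b) x = ∫ y, a y * conv f b (x - y) := by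
  rw [conv_eq, reflect_sconv, translate_sconv, apply_sconv,
    ← integral_neg_eq_self (fun y => a y * conv f b (x - y)) volume]
  refine integral_congr_ae (Filter.Eventually.of_forall fun t => ?_)
  simp only [translate_translate, reflect_apply, conv_eq, sub_neg_eq_add, add_comm t x]

theorem continuous_conv (f : 𝓢'(E d, ℂ)) (ψ : 𝓢(E d, ℂ)) : Continuous (conv f ψ) :=
  (show Continuous fun h : 𝓢(E d, ℂ) => f h from f.continuous).comp (continuous_translate _)

/-- This a priori growth bound is what later makes Peetre maximal functions finite, so that they can
be divided by. -/
theorem exists_norm_conv_le (f : 𝓢'(E d, ℂ)) (ψ : 𝓢(E d, ℂ)) :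
    ∃ C : ℝ, 0 ≤ C ∧ ∃ k : ℕ, ∀ x, ‖conv f ψ x‖ ≤ C * (1 + ‖x‖) ^ k := by
  obtain ⟨s, F, hF⟩ := exists_factor_weightedJet f
  obtain ⟨C, hC, k, hle⟩ := exists_norm_weightedJet_translate_le s (reflect ψ)
  refine ⟨‖F‖ * C, by positivity, k, fun x => ?_⟩
  rw [conv_eq, hF, mul_assoc]
  exact (F.le_opNorm _).trans (by gcongr; exact hle x)

theorem conv_sum {ι : Type*} (s : Finset ι) (f : 𝓢'(E d, ℂ)) (a : ι → 𝓢(E d, ℂ)) (x : E d) :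
    conv f (∑ i ∈ s, a i) x = ∑ i ∈ s, conv f (a i) x := by
  have : translate x (reflect (∑ i ∈ s, a i)) = ∑ i ∈ s, translate x (reflect (a i)) := by
    simp only [translate, reflect, map_sum]
  rw [conv_eq, this, map_sum]; rfl

end Exchange

/-! ### Dilations and the Fourier transform -/

section Dilation

variable {d : ℕ}

/-- Linear change of variables; `hS` says that S is the inverse transpose of T. -/
theorem fourier_comp_continuousLinearEquiv (T : E d ≃L[ℝ] E d) (S : E d → E d)
    (hS : ∀ x ξ, inner ℝ (T.symm x) ξ = inner ℝ x (S ξ)) (a : E d → ℂ) (ξ : E d) :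
    𝓕 (fun x => a (T x)) ξ = ((|LinearMap.det (T : E d →ₗ[ℝ] E d)|⁻¹ : ℝ) : ℂ) * 𝓕 a (S ξ) := by
  have hdet : LinearMap.det (T : E d →ₗ[ℝ] E d) ≠ 0 := T.toLinearEquiv.isUnit_det'.ne_zero
  have hmap := Measure.map_linearMap_addHaar_eq_smul_addHaar (volume : Measure (E d)) hdet
  rw [Real.fourier_eq, Real.fourier_eq]
  have h1 : ∀ v, Real.fourierChar (-inner ℝ v ξ) • a (T v) =
      (fun w => Real.fourierChar (-inner ℝ w (S ξ)) • a w) (T v) := by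
    intro v
    simp only
    rw [← hS, T.symm_apply_apply]
  simp_rw [h1]
  have h2 := (T.toHomeomorph.measurableEmbedding).integral_map (μ := (volume : Measure (E d)))
    (fun w => Real.fourierChar (-inner ℝ w (S ξ)) • a w)
  have h3 : Measure.map (⇑T.toHomeomorph) (volume : Measure (E d)) =
      Measure.map (⇑(T : E d →ₗ[ℝ] E d)) volume := rfl
  rw [h3, hmap, integral_smul_measure, ENNReal.toReal_ofReal (abs_nonneg _), abs_inv] at h2
  rw [← Complex.real_smul]
  exact h2.symm

/-- The `L¹`-normalized isotropic dilation `x ↦ |t|^d ψ (t x)`. -/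
def scale (t : ℝˣ) (ψ : 𝓢(E d, ℂ)) : 𝓢(E d, ℂ) :=
  (|(t : ℝ)| ^ d) • SchwartzMap.compCLMOfContinuousLinearEquiv ℂ
    (ContinuousLinearEquiv.smulLeft (M₁ := E d) (R₁ := ℝ) t) ψ

theorem scale_apply (t : ℝˣ) (ψ : 𝓢(E d, ℂ)) (x : E d) :
    scale t ψ x = (|(t : ℝ)| ^ d) • ψ ((t : ℝ) • x) := rfl

theorem scale_one (ψ : 𝓢(E d, ℂ)) : scale 1 ψ = ψ := by
  ext x
  simp [scale_apply]

theorem scale_scale (s t : ℝˣ) (ψ : 𝓢(E d, ℂ)) : scale s (scale t ψ) = scale (s * t) ψ := by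
  ext x
  rw [scale_apply, scale_apply, scale_apply, smul_smul, smul_smul, Units.val_mul, abs_mul, mul_pow,
    mul_comm (t : ℝ)]

theorem det_smulLeft (t : ℝˣ) :
    LinearMap.det ((ContinuousLinearEquiv.smulLeft (M₁ := E d) (R₁ := ℝ) t : E d ≃L[ℝ] E d) :
      E d →ₗ[ℝ] E d) = (t : ℝ) ^ d := by
  have : ((ContinuousLinearEquiv.smulLeft (M₁ := E d) (R₁ := ℝ) t : E d ≃L[ℝ] E d) :
      E d →ₗ[ℝ] E d) = (t : ℝ) • LinearMap.id := by
    ext x; rfl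
  rw [this, LinearMap.det_smul, LinearMap.det_id, mul_one, finrank_euclideanSpace_fin]

theorem fourier_scale (t : ℝˣ) (ψ : 𝓢(E d, ℂ)) (ξ : E d) :
    𝓕 (scale t ψ) ξ = 𝓕 ψ ((t : ℝ)⁻¹ • ξ) := by
  have h := fourier_comp_continuousLinearEquiv
    (ContinuousLinearEquiv.smulLeft (M₁ := E d) (R₁ := ℝ) t) (fun ξ => (t : ℝ)⁻¹ • ξ)
    (fun x ξ => by
      have : (ContinuousLinearEquiv.smulLeft (M₁ := E d) (R₁ := ℝ) t).symm x = (t : ℝ)⁻¹ • x := by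
        rw [ContinuousLinearEquiv.symm_apply_eq]
        change x = (t : ℝ) • (t : ℝ)⁻¹ • x
        rw [smul_inv_smul₀ t.ne_zero]
      rw [this, inner_smul_left, inner_smul_right]; rfl) ψ ξ
  rw [det_smulLeft, abs_pow] at h
  have h0 : 𝓕 (scale t ψ) = ((|(t : ℝ)| ^ d)) • 𝓕 (SchwartzMap.compCLMOfContinuousLinearEquiv ℂ
    (ContinuousLinearEquiv.smulLeft (M₁ := E d) (R₁ := ℝ) t) ψ) := by
    rw [scale, FourierTransform.fourier_smul]
  rw [h0, smul_apply]
  have h1 : 𝓕 (SchwartzMap.compCLMOfContinuousLinearEquiv ℂ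
    (ContinuousLinearEquiv.smulLeft (M₁ := E d) (R₁ := ℝ) t) ψ) ξ =
      𝓕 (fun x => ψ ((ContinuousLinearEquiv.smulLeft (M₁ := E d) (R₁ := ℝ) t) x)) ξ := rfl
  rw [h1, h, Complex.real_smul, ← mul_assoc, ← Complex.ofReal_mul, mul_inv_cancel₀
    (pow_ne_zero _ (abs_ne_zero.2 t.ne_zero)), Complex.ofReal_one, one_mul]
  rfl

theorem dyadicDilate_eq_scale (ν : ℕ) (φ : 𝓢(E d, ℂ)) :
    dyadicDilate ν φ = scale (Units.mk0 (2 : ℝ) two_ne_zero ^ ν) φ := by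
  rw [dyadicDilate, scale]
  congr 1
  rw [Units.val_pow_eq_pow_val, Units.val_mk0, abs_of_nonneg (by positivity), ← pow_mul, mul_comm]

end Dilation

/-! ### Reproducing formulas -/

section Reproducing

variable {d : ℕ}

theorem exists_smooth_cutoff {K U : Set (E d)} (hK : IsCompact K) (hU : IsOpen U) (hKU : K ⊆ U) :
    ∃ χ : E d → ℝ, ContDiff ℝ ∞ χ ∧ HasCompactSupport χ ∧ tsupport χ ⊆ U ∧ ∀ x ∈ K, χ x = 1 := by
  obtain ⟨L, hL, hKL, hLU⟩ := exists_compact_between hK hU hKU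
  obtain ⟨χ, h1, -, h3, h4⟩ := exists_contMDiff_support_eq_eq_one_iff (n := (⊤ : ℕ∞))
    (modelWithCornersSelf ℝ (E d)) (isOpen_interior (s := L)) hK.isClosed hKL
  have hsub : tsupport χ ⊆ L := by
    rw [tsupport, h3]
    exact hL.isClosed.closure_subset_iff.2 interior_subset
  exact ⟨χ, h1.contDiff, HasCompactSupport.of_support_subset_isCompact hL
    ((subset_tsupport _).trans hsub), hsub.trans hLU, fun x hx => (h4 x).1 hx⟩

theorem exists_fourier_eq {m : E d → ℂ} (hm : ContDiff ℝ ∞ m) (hc : HasCompactSupport m) :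
    ∃ ρ : 𝓢(E d, ℂ), ∀ ξ, 𝓕 ρ ξ = m ξ :=
  ⟨𝓕⁻ (hc.toSchwartzMap hm), fun ξ => by
    rw [FourierTransform.fourier_fourierInv_eq]; rfl⟩

/-- The transform of χ is a cutoff equal to 1 on the support of that of θ. Dilation acts on both at
once, so one χ serves every scale. -/
theorem exists_eq_sconv_self (θ : 𝓢(E d, ℂ)) (hθ : HasCompactSupport (𝓕 θ : 𝓢(E d, ℂ))) :
    ∃ χ : 𝓢(E d, ℂ), ∀ t : ℝˣ, scale t θ = sconv (scale t χ) (scale t θ) := by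
  obtain ⟨m, h1, h2, -, h4⟩ := exists_smooth_cutoff hθ isOpen_univ (Set.subset_univ _)
  obtain ⟨χ, hχ⟩ := exists_fourier_eq (m := fun x => (m x : ℂ))
    (Complex.ofRealCLM.contDiff.comp h1) (h2.comp_left Complex.ofReal_zero)
  refine ⟨χ, fun t => fourier_injective fun ξ => ?_⟩
  rw [fourier_sconv_apply, fourier_scale, fourier_scale, hχ]
  by_cases h : (𝓕 θ : 𝓢(E d, ℂ)) ((t : ℝ)⁻¹ • ξ) = 0
  · rw [h, mul_zero]
  · rw [h4 _ (subset_tsupport _ h), Complex.ofReal_one, one_mul]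

/-- Put D = ∑ |θ̂_μ|², which is positive on K, and let ρ̂_μ be the conjugate of θ̂_μ times χ / D,
where χ = 1 on K and is supported in D ≠ 0. Then ∑ ρ̂_μ θ̂_μ = 1 on K. The ρ_μ do not depend on t,
which keeps later constants uniform in the scale. -/
theorem exists_reproducing {ι : Type*} [Fintype ι] (θ : ι → 𝓢(E d, ℂ)) {K : Set (E d)}
    (hK : IsCompact K) (hθ : ∀ ξ ∈ K, ∃ μ, 𝓕 (θ μ) ξ ≠ 0) :
    ∃ ρ : ι → 𝓢(E d, ℂ), ∀ (t : ℝˣ) (ψ : 𝓢(E d, ℂ)), (∀ ξ, 𝓕 ψ ξ ≠ 0 → (t : ℝ)⁻¹ • ξ ∈ K) →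
      ψ = ∑ μ, sconv ψ (sconv (scale t (ρ μ)) (scale t (θ μ))) := by
  let D : E d → ℝ := fun ξ => ∑ μ, ‖(𝓕 (θ μ) : 𝓢(E d, ℂ)) ξ‖ ^ 2
  have hD : ContDiff ℝ ∞ D := ContDiff.sum fun μ _ => ((𝓕 (θ μ) : 𝓢(E d, ℂ)).smooth ⊤).norm_sq ℝ
  have hU : IsOpen {ξ | D ξ ≠ 0} := isOpen_ne_fun hD.continuous continuous_const
  have hKU : K ⊆ {ξ | D ξ ≠ 0} := by
    intro ξ hξ
    obtain ⟨μ, hμ⟩ := hθ ξ hξ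
    have : 0 < D ξ := Finset.sum_pos' (fun _ _ => by positivity)
      ⟨μ, Finset.mem_univ _, by have := norm_pos_iff.2 hμ; positivity⟩
    exact this.ne'
  obtain ⟨χ, h1, h2, h3, h4⟩ := exists_smooth_cutoff hK hU hKU
  have hq : ContDiff ℝ ∞ fun ξ => χ ξ / D ξ := by
    rw [contDiff_iff_contDiffAt]
    intro ξ
    by_cases hξ : ξ ∈ tsupport χ
    · exact h1.contDiffAt.div hD.contDiffAt (h3 hξ)
    · have : (fun ξ => χ ξ / D ξ) =ᶠ[nhds ξ] fun _ => 0 := by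
        filter_upwards [(isClosed_tsupport χ).isOpen_compl.mem_nhds hξ] with η hη
        rw [image_eq_zero_of_notMem_tsupport hη, zero_div]
      exact contDiffAt_const.congr_of_eventuallyEq this
  have hqc : HasCompactSupport fun ξ => χ ξ / D ξ := by
    have : (fun ξ => χ ξ / D ξ) = fun ξ => χ ξ * (D ξ)⁻¹ := by ext; rw [div_eq_mul_inv]
    rw [this]
    exact h2.mul_right
  have hex : ∀ μ, ∃ ρ : 𝓢(E d, ℂ), ∀ ξ, 𝓕 ρ ξ =
      ((χ ξ / D ξ : ℝ) : ℂ) * (starRingEnd ℂ) ((𝓕 (θ μ) : 𝓢(E d, ℂ)) ξ) := fun μ =>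
    exists_fourier_eq ((Complex.ofRealCLM.contDiff.comp hq).mul
      (Complex.conjCLE.contDiff.comp ((𝓕 (θ μ) : 𝓢(E d, ℂ)).smooth ⊤)))
      (HasCompactSupport.mul_right (hqc.comp_left Complex.ofReal_zero))
  choose ρ hρ using hex
  refine ⟨ρ, fun t ψ hψ => fourier_injective fun ξ => ?_⟩
  have hsum : 𝓕 (∑ μ, sconv ψ (sconv (scale t (ρ μ)) (scale t (θ μ)))) ξ =
      ∑ μ, 𝓕 (sconv ψ (sconv (scale t (ρ μ)) (scale t (θ μ)))) ξ := by
    have e : 𝓕 (∑ μ, sconv ψ (sconv (scale t (ρ μ)) (scale t (θ μ)))) =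
        ∑ μ, 𝓕 (sconv ψ (sconv (scale t (ρ μ)) (scale t (θ μ)))) :=
      map_sum (FourierTransform.fourierCLM ℂ 𝓢(E d, ℂ)) _ _
    rw [e, sum_apply]
  rw [hsum]
  simp_rw [fourier_sconv_apply, fourier_scale, hρ]
  by_cases h0 : (𝓕 ψ : 𝓢(E d, ℂ)) ξ = 0
  · simp [h0]
  have hmem := hψ ξ h0
  set η := (t : ℝ)⁻¹ • ξ
  have hDη : (D η : ℂ) ≠ 0 := Complex.ofReal_ne_zero.2 (hKU hmem)
  rw [← Finset.mul_sum]
  have : ∑ μ, (((χ η / D η : ℝ) : ℂ) * (starRingEnd ℂ) ((𝓕 (θ μ) : 𝓢(E d, ℂ)) η)) *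
      (𝓕 (θ μ) : 𝓢(E d, ℂ)) η = 1 := by
    rw [h4 η hmem]
    simp_rw [mul_assoc, Complex.conj_mul', ← Finset.mul_sum]
    rw [one_div, Complex.ofReal_inv, inv_mul_eq_one₀ hDη]
    simp [D]
  rw [this, mul_one]

end Reproducing

/-! ### Polynomial weights -/

section Weight

variable {d : ℕ}

/-- The weight `(1 + t |x|)^s`. -/
def weight (t s : ℝ) (x : E d) : ℝ≥0∞ := ENNReal.ofReal ((1 + t * ‖x‖) ^ s)

variable {t : ℝ} (ht : 0 ≤ t)

theorem measurable_weight (t s : ℝ) : Measurable (weight t s : E d → ℝ≥0∞) := by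
  unfold weight
  fun_prop

include ht

theorem one_le_base (x : E d) : 1 ≤ 1 + t * ‖x‖ := by
  have := mul_nonneg ht (norm_nonneg x); linarith

theorem base_pos (x : E d) : 0 < 1 + t * ‖x‖ := zero_lt_one.trans_le (one_le_base ht x)

theorem weight_add (s s' : ℝ) (x : E d) : weight t (s + s') x = weight t s x * weight t s' x := by
  rw [weight, Real.rpow_add (base_pos ht x), ENNReal.ofReal_mul (by have := base_pos ht x; positivity)]
  rfl

omit ht in
theorem weight_zero (t : ℝ) (x : E d) : weight t 0 x = 1 := by simp [weight]

theorem weight_mul_neg (s : ℝ) (x : E d) : weight t s x * weight t (-s) x = 1 := by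
  rw [← weight_add ht, add_neg_cancel, weight_zero]

theorem weight_rpow (s : ℝ) {r : ℝ} (hr : 0 ≤ r) (x : E d) :
    weight t s x ^ r = weight t (s * r) x := by
  have := base_pos ht x
  rw [weight, ENNReal.ofReal_rpow_of_nonneg (by positivity) hr, ← Real.rpow_mul this.le]
  rfl

theorem weight_mono {s s' : ℝ} (h : s ≤ s') (x : E d) : weight t s x ≤ weight t s' x :=
  ENNReal.ofReal_le_ofReal (Real.rpow_le_rpow_of_exponent_le (one_le_base ht x) h)

theorem weight_add_le {s : ℝ} (hs : 0 ≤ s) (x y : E d) :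
    weight t s (x + y) ≤ weight t s x * weight t s y := by
  have hx := base_pos ht x
  have hy := base_pos ht y
  have hxy := base_pos ht (x + y)
  rw [weight, weight, weight, ← ENNReal.ofReal_mul (by positivity), ← Real.mul_rpow hx.le hy.le]
  refine ENNReal.ofReal_le_ofReal (Real.rpow_le_rpow hxy.le ?_ hs)
  have h1 : t * ‖x + y‖ ≤ t * (‖x‖ + ‖y‖) := mul_le_mul_of_nonneg_left (norm_add_le x y) ht
  have h2 : 0 ≤ (t * ‖x‖) * (t * ‖y‖) := by positivity
  nlinarith

/-- Submultiplicativity of the weight, divided by its values at y and x + y. -/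
theorem weight_neg_le {s : ℝ} (hs : 0 ≤ s) (x y : E d) :
    weight t (-s) y ≤ weight t (-s) (x + y) * weight t s x := by
  calc weight t (-s) y = (weight t s (x + y) * weight t (-s) (x + y)) * weight t (-s) y := by
        rw [weight_mul_neg ht, one_mul]
    _ ≤ ((weight t s x * weight t s y) * weight t (-s) (x + y)) * weight t (-s) y := by
        gcongr
        exact weight_add_le ht hs x y
    _ = weight t (-s) (x + y) * weight t s x * (weight t s y * weight t (-s) y) := by ring
    _ = _ := by rw [weight_mul_neg ht, mul_one]

omit ht in
theorem weight_ne_top (t s : ℝ) (x : E d) : weight t s x ≠ ⊤ := ENNReal.ofReal_ne_top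

omit ht in
theorem weight_neg_arg (t s : ℝ) (x : E d) : weight t s (-x) = weight t s x := by
  rw [weight, norm_neg]; rfl

end Weight

/-! ### The Peetre maximal inequality -/

section Peetre

variable {d : ℕ} {t : ℝ} (ht : 0 < t)

/-- The Peetre maximal function. -/
def peetre (t a : ℝ) (g : E d → ℝ≥0∞) (x : E d) : ℝ≥0∞ := ⨆ z, g z * weight t (-a) (x - z)

/-- The weighted average of the `r`-th power of a function. -/
def average (t a r : ℝ) (g : E d → ℝ≥0∞) (x : E d) : ℝ≥0∞ :=
  ∫⁻ y, weight t (-(a * r)) (x - y) * g y ^ r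

include ht

/-- Write S for the maximal function at x and split b = b^{1-r} b^r under the integral. Bounding the
first factor by S^{1-r} gives S ≤ S^{1-r} · K · average, and since S is finite S^{1-r} can be
cancelled. -/
theorem peetre_rpow_le_of_ne_top {a r : ℝ} (ha : 0 ≤ a) (hr : 0 < r) (hr1 : r ≤ 1)
    {g : E d → ℝ≥0∞} {K : ℝ≥0∞}
    (hg : ∀ z, g z ≤ K * ∫⁻ y, weight t (-a) (z - y) * g y) {x : E d}
    (hx : peetre t a g x ≠ ⊤) : peetre t a g x ^ r ≤ K * average t a r g x := by
  set S := peetre t a g x with hS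
  have hle : ∀ y, g y * weight t (-a) (x - y) ≤ S := fun y => le_iSup
    (fun z => g z * weight t (-a) (x - z)) y
  have hSr : S ^ (1 - r) ≠ ⊤ := ENNReal.rpow_ne_top_of_nonneg (by linarith) hx
  have hpt : ∀ y, g y * weight t (-a) (x - y) ≤
      S ^ (1 - r) * (weight t (-(a * r)) (x - y) * g y ^ r) := by
    intro y
    set b := g y * weight t (-a) (x - y) with hb
    have h1 : b ^ r = weight t (-(a * r)) (x - y) * g y ^ r := by
      rw [hb, ENNReal.mul_rpow_of_nonneg _ _ hr.le, weight_rpow ht.le _ hr.le, neg_mul, mul_comm]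
    rw [← h1]
    calc b = b ^ ((1 - r) + r) := by simp
      _ = b ^ (1 - r) * b ^ r := ENNReal.rpow_add_of_nonneg _ _ (by linarith) hr.le
      _ ≤ _ := by
        have h0 : 0 ≤ 1 - r := by linarith
        gcongr
        exact hle y
  have hmain : S ≤ S ^ (1 - r) * (K * average t a r g x) := by
    refine iSup_le fun z => ?_
    calc g z * weight t (-a) (x - z)
        ≤ (K * ∫⁻ y, weight t (-a) (z - y) * g y) * weight t (-a) (x - z) := by
          gcongr; exact hg z
      _ = K * ∫⁻ y, weight t (-a) (x - z) * (weight t (-a) (z - y) * g y) := by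
          rw [lintegral_const_mul' _ _ (weight_ne_top _ _ _)]; ring
      _ ≤ K * ∫⁻ y, S ^ (1 - r) * (weight t (-(a * r)) (x - y) * g y ^ r) := by
          gcongr K * ?_
          refine lintegral_mono fun y => le_trans ?_ (hpt y)
          rw [← mul_assoc, mul_comm (g y)]
          gcongr
          have h := weight_neg_le ht.le ha (x - z) (z - y)
          rw [sub_add_sub_cancel] at h
          calc weight t (-a) (x - z) * weight t (-a) (z - y)
              ≤ weight t (-a) (x - z) * (weight t (-a) (x - y) * weight t a (x - z)) := by gcongr
            _ = weight t (-a) (x - y) * (weight t a (x - z) * weight t (-a) (x - z)) := by ring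
            _ = _ := by rw [weight_mul_neg ht.le, mul_one]
      _ = _ := by
          rw [lintegral_const_mul' _ _ hSr, average]; ring
  rcases eq_or_ne S 0 with h0 | h0
  · rw [h0, ENNReal.zero_rpow_of_pos hr]; exact zero_le
  have hpos : S ^ (1 - r) ≠ 0 := by
    rw [ne_eq, ENNReal.rpow_eq_zero_iff]
    rintro (⟨h, -⟩ | ⟨h, -⟩)
    exacts [h0 h, hx h]
  have : S ^ (1 - r) * S ^ r ≤ S ^ (1 - r) * (K * average t a r g x) := by
    rw [← ENNReal.rpow_add_of_nonneg _ _ (by linarith) hr.le, sub_add_cancel, ENNReal.rpow_one]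
    exact hmain
  exact (ENNReal.mul_le_mul_iff_right hpos hSr).1 this

theorem peetre_ne_top_of_growth {g : E d → ℝ≥0∞} {C a : ℝ} (ha : 0 ≤ a)
    (hg : ∀ z, g z ≤ ENNReal.ofReal C * weight 1 a z) (x : E d) : peetre t a g x ≠ ⊤ := by
  have hc : ∀ z : E d, weight 1 a z ≤ ENNReal.ofReal ((max 1 t⁻¹) ^ a) * weight t a z := by
    intro z
    have hm : 0 < max 1 t⁻¹ := lt_max_of_lt_left one_pos
    have hb := base_pos ht.le z
    rw [weight, weight, ← ENNReal.ofReal_mul (by positivity), ← Real.mul_rpow hm.le hb.le]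
    refine ENNReal.ofReal_le_ofReal (Real.rpow_le_rpow (by positivity) ?_ ha)
    have h1 : ‖z‖ ≤ max 1 t⁻¹ * (t * ‖z‖) := by
      calc ‖z‖ = t⁻¹ * (t * ‖z‖) := by rw [inv_mul_cancel_left₀ ht.ne']
        _ ≤ _ := by gcongr; exact le_max_right _ _
    have h2 : 1 ≤ max 1 t⁻¹ := le_max_left _ _
    linarith
  refine ne_top_of_le_ne_top (b := ENNReal.ofReal C * (weight 1 a x *
    ENNReal.ofReal ((max 1 t⁻¹) ^ a))) (by
      exact ENNReal.mul_ne_top ENNReal.ofReal_ne_top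
        (ENNReal.mul_ne_top (weight_ne_top _ _ _) ENNReal.ofReal_ne_top)) (iSup_le fun z => ?_)
  have hz : weight 1 a z ≤ weight 1 a x * weight 1 a (x - z) := by
    have := weight_add_le zero_le_one ha x (-(x - z))
    rwa [weight_neg_arg, neg_sub, add_sub_cancel] at this
  calc g z * weight t (-a) (x - z)
      ≤ (ENNReal.ofReal C * (weight 1 a x * (ENNReal.ofReal ((max 1 t⁻¹) ^ a) *
          weight t a (x - z)))) * weight t (-a) (x - z) := by
        gcongr
        refine (hg z).trans ?_
        gcongr
        refine hz.trans ?_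
        gcongr
        exact hc _
    _ = ENNReal.ofReal C * (weight 1 a x * ENNReal.ofReal ((max 1 t⁻¹) ^ a)) *
          (weight t a (x - z) * weight t (-a) (x - z)) := by ring
    _ = _ := by rw [weight_mul_neg ht.le, mul_one]

/-- Finiteness is bootstrapped. For a' at least the growth exponent of g the maximal function is
finite, so the previous lemma bounds g^r pointwise by an average, a fortiori by the average with
exponent a. If the latter is finite at x, this bound makes the maximal function with exponent a
finite at x too. The constant K a' serves only this purpose. -/
theorem peetre_rpow_le {a r : ℝ} (ha : 0 ≤ a) (hr : 0 < r) (hr1 : r ≤ 1) {g : E d → ℝ≥0∞}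
    {K : ℝ → ℝ≥0∞} (hK : ∀ b, K b ≠ ⊤) (hK0 : ∀ b, K b ≠ 0)
    (hg : ∀ b, 0 ≤ b → ∀ z, g z ≤ K b * ∫⁻ y, weight t (-b) (z - y) * g y)
    (hgrowth : ∃ C b : ℝ, ∀ z, g z ≤ ENNReal.ofReal C * weight 1 b z) (x : E d) :
    peetre t a g x ^ r ≤ K a * average t a r g x := by
  rcases eq_or_ne (average t a r g x) ⊤ with hI | hI
  · rw [hI, ENNReal.mul_top (hK0 a)]; exact le_top
  refine peetre_rpow_le_of_ne_top ht ha hr hr1 (hg a ha) ?_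
  obtain ⟨C, b, hC⟩ := hgrowth
  set a' := max a b with ha'
  have ha0 : 0 ≤ a' := ha.trans (le_max_left _ _)
  have h1 : ∀ z, g z ^ r ≤ K a' * average t a r g z := by
    intro z
    have hfin : peetre t a' g z ≠ ⊤ := peetre_ne_top_of_growth ht (C := C) ha0 (fun w =>
      (hC w).trans (by gcongr; exact weight_mono zero_le_one (le_max_right _ _) w)) z
    have h2 := peetre_rpow_le_of_ne_top ht ha0 hr hr1 (hg a' ha0) hfin
    calc g z ^ r ≤ peetre t a' g z ^ r := by
          gcongr
          refine le_trans ?_ (le_iSup (fun w => g w * weight t (-a') (z - w)) z)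
          simp [weight]
      _ ≤ K a' * average t a' r g z := h2
      _ ≤ _ := by
          unfold average
          gcongr with y
          refine weight_mono ht.le ?_ _
          have : a * r ≤ a' * r := by gcongr; exact le_max_left _ _
          linarith
  have h3 : ∀ z, average t a r g z ≤ average t a r g x * weight t (a * r) (x - z) := by
    intro z
    rw [average, average, ← lintegral_mul_const' _ _ (weight_ne_top _ _ _)]
    refine lintegral_mono fun y => ?_
    have := weight_neg_le ht.le (mul_nonneg ha hr.le) (x - z) (z - y)
    rw [sub_add_sub_cancel] at this
    calc weight t (-(a * r)) (z - y) * g y ^ r ≤ weight t (-(a * r)) (x - y) * weight t (a * r) (x - z) * g y ^ r := by gcongr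
      _ = _ := by ring
  have h4 : peetre t a g x ≤ (K a' * average t a r g x) ^ r⁻¹ := by
    refine iSup_le fun z => ?_
    rw [ENNReal.le_rpow_inv_iff hr, ENNReal.mul_rpow_of_nonneg _ _ hr.le,
      weight_rpow ht.le _ hr.le, neg_mul]
    calc g z ^ r * weight t (-(a * r)) (x - z)
        ≤ (K a' * (average t a r g x * weight t (a * r) (x - z))) *
            weight t (-(a * r)) (x - z) := by
          gcongr
          exact (h1 z).trans (by gcongr; exact h3 z)
      _ = K a' * average t a r g x * (weight t (a * r) (x - z) * weight t (-(a * r)) (x - z)) := by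
          ring
      _ = _ := by rw [weight_mul_neg ht.le, mul_one]
  exact ne_top_of_le_ne_top (ENNReal.rpow_ne_top_of_nonneg (by positivity)
    (ENNReal.mul_ne_top (hK a') hI)) h4

end Peetre

/-! ### Young's inequality -/

section Young

variable {d : ℕ}

/-- Hölder for the measure η dμ: split η = η^{1/s'} η^{1/s}. -/
theorem lintegral_mul_rpow_le {α : Type*} [MeasurableSpace α] (μ : Measure α) {η h : α → ℝ≥0∞}
    (hη : Measurable η) (hh : Measurable h) {s : ℝ} (hs : 1 ≤ s) :
    (∫⁻ y, η y * h y ∂μ) ^ s ≤ (∫⁻ y, η y ∂μ) ^ (s - 1) * ∫⁻ y, η y * h y ^ s ∂μ := by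
  rcases hs.eq_or_lt with rfl | hs
  · simp
  have hs0 : 0 < s := by linarith
  have hpq : (Real.conjExponent s).HolderConjugate s := (Real.HolderConjugate.conjExponent hs).symm
  set s' := Real.conjExponent s
  have hs' : 0 < s' := hpq.pos
  have hH := ENNReal.lintegral_mul_le_Lp_mul_Lq μ hpq (f := fun y => η y ^ (1 / s'))
    (g := fun y => η y ^ (1 / s) * h y) (by fun_prop) (by fun_prop)
  have e1 : ∀ y, η y ^ (1 / s') * (η y ^ (1 / s) * h y) = η y * h y := by
    intro y
    rw [← mul_assoc, ← ENNReal.rpow_add_of_nonneg _ _ (by positivity) (by positivity), one_div,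
      one_div, hpq.inv_add_inv_eq_one, ENNReal.rpow_one]
  have e2 : ∀ y, (η y ^ (1 / s')) ^ s' = η y := fun y => by
    rw [← ENNReal.rpow_mul, one_div_mul_cancel hs'.ne', ENNReal.rpow_one]
  have e3 : ∀ y, (η y ^ (1 / s) * h y) ^ s = η y * h y ^ s := fun y => by
    rw [ENNReal.mul_rpow_of_nonneg _ _ hs0.le, ← ENNReal.rpow_mul, one_div_mul_cancel hs0.ne',
      ENNReal.rpow_one]
  simp only [Pi.mul_apply, e1, e2, e3] at hH
  calc (∫⁻ y, η y * h y ∂μ) ^ s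
      ≤ ((∫⁻ y, η y ∂μ) ^ (1 / s') * (∫⁻ y, η y * h y ^ s ∂μ) ^ (1 / s)) ^ s := by gcongr
    _ = _ := by
      rw [ENNReal.mul_rpow_of_nonneg _ _ hs0.le, ← ENNReal.rpow_mul, ← ENNReal.rpow_mul,
        one_div_mul_cancel hs0.ne', ENNReal.rpow_one]
      congr 2
      have := hpq.inv_add_inv_eq_one
      have h2 : s'⁻¹ = 1 - s⁻¹ := by linarith
      rw [one_div, h2, sub_mul, one_mul, inv_mul_cancel₀ hs0.ne']

/-- Hölder for the measure with density η(x - ·), then Tonelli and translation invariance. -/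
theorem lintegral_convolution_rpow_le {η h : E d → ℝ≥0∞} (hη : Measurable η) (hh : Measurable h)
    {s : ℝ} (hs : 1 ≤ s) :
    ∫⁻ x, (∫⁻ y, η (x - y) * h y) ^ s ≤ (∫⁻ y, η y) ^ s * ∫⁻ y, h y ^ s := by
  have hm : Measurable fun p : E d × E d => η (p.1 - p.2) * h p.2 ^ s := by fun_prop
  calc ∫⁻ x, (∫⁻ y, η (x - y) * h y) ^ s
      ≤ ∫⁻ x, (∫⁻ y, η y) ^ (s - 1) * ∫⁻ y, η (x - y) * h y ^ s := by
        refine lintegral_mono fun x => ?_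
        have := lintegral_mul_rpow_le volume (η := fun y => η (x - y)) (h := h) (by fun_prop) hh hs
        rwa [lintegral_sub_left_eq_self η x] at this
    _ = (∫⁻ y, η y) ^ (s - 1) * ∫⁻ x, ∫⁻ y, η (x - y) * h y ^ s :=
        lintegral_const_mul _ hm.lintegral_prod_right'
    _ = (∫⁻ y, η y) ^ (s - 1) * ∫⁻ y, ∫⁻ x, η (x - y) * h y ^ s := by
        rw [lintegral_lintegral_swap hm.aemeasurable]
    _ = (∫⁻ y, η y) ^ (s - 1) * ∫⁻ y, (∫⁻ x, η x) * h y ^ s := by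
        congr 1
        refine lintegral_congr fun y => ?_
        rw [lintegral_mul_const _ (by fun_prop), lintegral_sub_right_eq_self η y]
    _ = (∫⁻ y, η y) ^ (s - 1) * ((∫⁻ x, η x) * ∫⁻ y, h y ^ s) := by
        rw [lintegral_const_mul _ (by fun_prop)]
    _ = _ := by
        rw [← mul_assoc]
        congr 1
        nth_rw 2 [← ENNReal.rpow_one (∫⁻ x, η x)]
        rw [← ENNReal.rpow_add_of_nonneg _ _ (by linarith) zero_le_one, sub_add_cancel]

end Young

/-! ### Pointwise and integral control of convolutions by band-limited pieces -/

section Moment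

variable {d : ℕ}

/-- The weighted `L¹` norm `∫ |ψ(y)| (1 + t |y|)^a dy`. -/
def moment (t a : ℝ) (ψ : 𝓢(E d, ℂ)) : ℝ≥0∞ := ∫⁻ y, ‖ψ y‖ₑ * weight t a y

theorem exists_norm_le_rpow (χ : 𝓢(E d, ℂ)) (a : ℝ) :
    ∃ C : ℝ, 0 < C ∧ ∀ u, ‖χ u‖ ≤ C * (1 + ‖u‖) ^ (-a) := by
  obtain ⟨C, hC, h⟩ := exists_weighted_iteratedFDeriv_le χ ⌈max a 0⌉₊ 0
  set k := ⌈max a 0⌉₊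
  have h0 := SchwartzMap.one_add_le_sup_seminorm_apply (𝕜 := ℝ) (m := (k, 0)) le_rfl le_rfl χ
  set M : ℝ := 2 ^ k * ((Finset.Iic (k, 0)).sup fun m => SchwartzMap.seminorm ℝ m.1 m.2) χ
  have hM : 0 ≤ M := by positivity
  refine ⟨M + 1, by linarith, fun u => ?_⟩
  have h1 : (1 + ‖u‖) ^ k * ‖χ u‖ ≤ M := by simpa [norm_iteratedFDeriv_zero] using h0 u
  have hb : 1 ≤ 1 + ‖u‖ := by linarith [norm_nonneg u]
  have h2 : (1 + ‖u‖) ^ a ≤ (1 + ‖u‖) ^ k := by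
    rw [← Real.rpow_natCast]
    exact Real.rpow_le_rpow_of_exponent_le hb ((le_max_left _ _).trans (Nat.le_ceil _))
  rw [Real.rpow_neg (by linarith), ← div_eq_mul_inv, le_div_iff₀ (by positivity), mul_comm]
  calc (1 + ‖u‖) ^ a * ‖χ u‖ ≤ (1 + ‖u‖) ^ k * ‖χ u‖ := by gcongr
    _ ≤ M + 1 := by linarith

theorem ofReal_pow_mul_lintegral_comp_smul {t : ℝ} (ht : 0 < t) (H : E d → ℝ≥0∞) :
    ENNReal.ofReal (t ^ d) * ∫⁻ y, H (t • y) = ∫⁻ y, H y := by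
  have h := Measure.map_addHaar_smul (volume : Measure (E d)) ht.ne'
  have h2 := ((Homeomorph.smulOfNeZero t ht.ne').measurableEmbedding).lintegral_map
    (μ := (volume : Measure (E d))) H
  have h3 : Measure.map (⇑(Homeomorph.smulOfNeZero t ht.ne' : E d ≃ₜ E d)) volume =
    Measure.map (t • ·) (volume : Measure (E d)) := rfl
  have hpos : 0 < t ^ d := by positivity
  rw [h3, h, lintegral_smul_measure, finrank_euclideanSpace_fin, abs_of_nonneg (by positivity),
    smul_eq_mul, ENNReal.ofReal_inv_of_pos hpos] at h2
  change _ = ∫⁻ y, H (t • y) at h2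
  rw [← h2, ← mul_assoc, ENNReal.mul_inv_cancel (by simpa using hpos) ENNReal.ofReal_ne_top, one_mul]

theorem weight_one_smul {t : ℝ} (ht : 0 < t) (s : ℝ) (y : E d) :
    weight 1 s (t • y) = weight t s y := by
  rw [weight, weight, norm_smul, Real.norm_of_nonneg ht.le, one_mul]

theorem ofReal_pow_mul_lintegral_weight {t : ℝ} (ht : 0 < t) (s : ℝ) :
    ENNReal.ofReal (t ^ d) * ∫⁻ y : E d, weight t s y = ∫⁻ y : E d, weight 1 s y := by
  rw [← ofReal_pow_mul_lintegral_comp_smul ht (weight 1 s)]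
  simp_rw [weight_one_smul ht]

theorem lintegral_weight_ne_top {s : ℝ} (hs : (d : ℝ) < s) : ∫⁻ y : E d, weight 1 (-s) y ≠ ⊤ := by
  have h := finite_integral_one_add_norm (E := E d) (μ := volume) (r := s)
    (by rwa [finrank_euclideanSpace_fin])
  simpa [weight] using h.ne

theorem enorm_scale (t : ℝˣ) (ht : 0 < (t : ℝ)) (ψ : 𝓢(E d, ℂ)) (y : E d) :
    ‖scale t ψ y‖ₑ = ENNReal.ofReal ((t : ℝ) ^ d) * ‖ψ ((t : ℝ) • y)‖ₑ := by
  rw [scale_apply, enorm_smul, Real.enorm_of_nonneg (by positivity), abs_of_pos ht]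

/-- Weight and kernel dilate together, so the moments of the auxiliary kernels are independent of
the scale. -/
theorem moment_scale (t : ℝˣ) (ht : 0 < (t : ℝ)) (a : ℝ) (ψ : 𝓢(E d, ℂ)) :
    moment t a (scale t ψ) = moment 1 a ψ := by
  rw [moment, moment, ← ofReal_pow_mul_lintegral_comp_smul ht (fun y => ‖ψ y‖ₑ * weight 1 a y),
    ← lintegral_const_mul' _ _ ENNReal.ofReal_ne_top]
  refine lintegral_congr fun y => ?_
  rw [enorm_scale t ht, weight_one_smul ht, mul_assoc]

theorem enorm_le_ofReal_mul_weight {χ : 𝓢(E d, ℂ)} {C a : ℝ} (hC : 0 < C)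
    (h : ∀ u, ‖χ u‖ ≤ C * (1 + ‖u‖) ^ (-a)) (y : E d) :
    ‖χ y‖ₑ ≤ ENNReal.ofReal C * weight 1 (-a) y := by
  rw [← ofReal_norm, weight, ← ENNReal.ofReal_mul hC.le, one_mul]
  exact ENNReal.ofReal_le_ofReal (h y)

theorem moment_one_ne_top (a : ℝ) (ψ : 𝓢(E d, ℂ)) : moment 1 a ψ ≠ ⊤ := by
  obtain ⟨C, hC, h⟩ := exists_norm_le_rpow ψ (a + (d + 1))
  have hle : moment 1 a ψ ≤ ENNReal.ofReal C * ∫⁻ y : E d, weight 1 (-((d : ℝ) + 1)) y := by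
    rw [moment, ← lintegral_const_mul' _ _ ENNReal.ofReal_ne_top]
    refine lintegral_mono fun y => ?_
    calc ‖ψ y‖ₑ * weight 1 a y
        ≤ (ENNReal.ofReal C * weight 1 (-(a + (d + 1))) y) * weight 1 a y := by
          gcongr; exact enorm_le_ofReal_mul_weight hC h y
      _ = ENNReal.ofReal C * weight 1 (-((d : ℝ) + 1)) y := by
          rw [mul_assoc, ← weight_add zero_le_one]; congr 2; ring
  exact ne_top_of_le_ne_top (ENNReal.mul_ne_top ENNReal.ofReal_ne_top
    (lintegral_weight_ne_top (by linarith))) hle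

theorem enorm_conv_sconv_le (f : 𝓢'(E d, ℂ)) (a b : 𝓢(E d, ℂ)) (x : E d) :
    ‖conv f (sconv a b) x‖ₑ ≤ ∫⁻ y, ‖a y‖ₑ * ‖conv f b (x - y)‖ₑ := by
  rw [conv_sconv]
  refine (enorm_integral_le_lintegral_enorm _).trans (le_of_eq ?_)
  simp_rw [enorm_mul]

/-- A bound growing like the weight survives convolution with c at the price of one moment, so the
estimate can be iterated over several convolution factors. -/
theorem enorm_conv_sconv_sub_le {t a : ℝ} (ht : 0 ≤ t) (ha : 0 ≤ a) (f : 𝓢'(E d, ℂ))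
    (b c : 𝓢(E d, ℂ)) {x : E d} {P : ℝ≥0∞}
    (hP : ∀ w, ‖conv f b (x - w)‖ₑ ≤ P * weight t a w) (w : E d) :
    ‖conv f (sconv c b) (x - w)‖ₑ ≤ (moment t a c * P) * weight t a w := by
  have hm : Measurable fun y => ‖c y‖ₑ * weight t a y :=
    c.continuous.measurable.enorm.mul (measurable_weight t a)
  calc ‖conv f (sconv c b) (x - w)‖ₑ ≤ ∫⁻ y, ‖c y‖ₑ * ‖conv f b (x - w - y)‖ₑ :=
        enorm_conv_sconv_le f c b _
    _ ≤ ∫⁻ y, (‖c y‖ₑ * weight t a y) * (P * weight t a w) := by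
        refine lintegral_mono fun y => ?_
        rw [sub_sub]
        calc _ ≤ ‖c y‖ₑ * (P * (weight t a w * weight t a y)) := by
              gcongr
              exact (hP (w + y)).trans (by gcongr; exact weight_add_le ht ha w y)
          _ = _ := by ring
    _ = _ := by
        rw [lintegral_mul_const _ hm, moment]; ring

end Moment

/-! ### L^p majorants for convolutions with band-limited kernels. -/

section Majorant

variable {d : ℕ}

/-- Comparison with the largest term treats p < 1 and p ≥ 1 alike; the size of the constant is
immaterial. -/
theorem sum_rpow_le {ι : Type*} (s : Finset ι) (v : ι → ℝ≥0∞) {p : ℝ} (hp : 0 < p) :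
    (∑ i ∈ s, v i) ^ p ≤ (s.card : ℝ≥0∞) ^ p * ∑ i ∈ s, v i ^ p := by
  rcases s.eq_empty_or_nonempty with rfl | hs
  · simp [hp]
  obtain ⟨i, hi, hmax⟩ := s.exists_max_image v hs
  calc (∑ i ∈ s, v i) ^ p ≤ (s.card * v i) ^ p := by
        gcongr
        rw [← nsmul_eq_mul]
        exact Finset.sum_le_card_nsmul _ _ _ hmax
    _ = (s.card : ℝ≥0∞) ^ p * v i ^ p := ENNReal.mul_rpow_of_nonneg _ _ hp.le
    _ ≤ _ := by
        gcongr
        exact Finset.single_le_sum (f := fun i => v i ^ p) (fun _ _ => zero_le) hi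

/-- `L^p` control, `0 < p < ∞`, of the Peetre maximal function of a band-limited function. -/
theorem exists_peetre_majorant (θ : 𝓢(E d, ℂ)) (hθ : HasCompactSupport (𝓕 θ : 𝓢(E d, ℂ)))
    {p a : ℝ} (hp : 0 < p) (ha : (d : ℝ) < a * min 1 p) :
    ∃ C : ℝ≥0∞, C ≠ ⊤ ∧ ∀ t : ℝˣ, 0 < (t : ℝ) → ∀ f : 𝓢'(E d, ℂ),
      ∃ V : E d → ℝ≥0∞, Measurable V ∧
        ∫⁻ x, V x ^ p ≤ C * ∫⁻ x, ‖conv f (scale t θ) x‖ₑ ^ p ∧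
        ∀ x, peetre t a (fun z => ‖conv f (scale t θ) z‖ₑ) x ≤ V x := by
  obtain ⟨χ, hχ⟩ := exists_eq_sconv_self θ hθ
  choose C hC hCχ using exists_norm_le_rpow χ
  -- This r satisfies both demands: r ≤ 1 for the Peetre inequality and p / r ≥ 1 for Young's. The
  -- hypothesis a·r > d makes the weight integrable.
  set r := min 1 p with hr
  have hr0 : 0 < r := lt_min one_pos hp
  have hr1 : r ≤ 1 := min_le_left _ _
  have ha0 : 0 ≤ a := by
    by_contra! h
    have : a * r ≤ 0 := by nlinarith
    have : (0 : ℝ) ≤ d := Nat.cast_nonneg d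
    linarith
  have hpr : 1 ≤ p / r := by rw [le_div_iff₀ hr0, one_mul]; exact min_le_right _ _
  refine ⟨(ENNReal.ofReal (C a) * ∫⁻ y : E d, weight 1 (-(a * r)) y) ^ (p / r),
    ENNReal.rpow_ne_top_of_nonneg (by positivity)
      (ENNReal.mul_ne_top ENNReal.ofReal_ne_top (lintegral_weight_ne_top ha)), fun t ht f => ?_⟩
  set g : E d → ℝ≥0∞ := fun z => ‖conv f (scale t θ) z‖ₑ with hg
  have hgm : Measurable g := (continuous_conv f _).measurable.enorm
  have htd : 0 < (t : ℝ) ^ d := by positivity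
  -- The factor t^d comes from the L¹ normalization of the dilate; it cancels at the end against the
  -- integral of the weight at scale t.
  let K : ℝ → ℝ≥0∞ := fun b => ENNReal.ofReal (C b) * ENNReal.ofReal ((t : ℝ) ^ d)
  have hKt : ∀ b, K b ≠ ⊤ := fun b => ENNReal.mul_ne_top ENNReal.ofReal_ne_top ENNReal.ofReal_ne_top
  have hK0 : ∀ b, K b ≠ 0 := fun b => mul_ne_zero (by simpa using hC b) (by simpa using htd)
  have hrep : ∀ b, 0 ≤ b → ∀ z, g z ≤ K b * ∫⁻ y, weight t (-b) (z - y) * g y := by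
    intro b _ z
    have h1 : g z ≤ ∫⁻ y, ‖scale t χ y‖ₑ * g (z - y) := by
      have := enorm_conv_sconv_le f (scale t χ) (scale t θ) z
      rwa [← hχ t] at this
    calc g z ≤ ∫⁻ y, ‖scale t χ y‖ₑ * g (z - y) := h1
      _ ≤ ∫⁻ y, K b * (weight t (-b) y * g (z - y)) := by
          refine lintegral_mono fun y => ?_
          rw [enorm_scale t ht]
          calc _ ≤ ENNReal.ofReal ((t : ℝ) ^ d) *
                (ENNReal.ofReal (C b) * weight 1 (-b) ((t : ℝ) • y)) * g (z - y) := by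
                gcongr; exact enorm_le_ofReal_mul_weight (hC b) (hCχ b) _
            _ = _ := by rw [weight_one_smul ht]; ring
      _ = K b * ∫⁻ y, weight t (-b) y * g (z - y) := lintegral_const_mul' _ _ (hKt b)
      _ = K b * ∫⁻ y, weight t (-b) (z - y) * g y := by
          rw [← lintegral_sub_left_eq_self (fun y => weight t (-b) (z - y) * g y) z]
          simp only [sub_sub_cancel]
  have hgrowth : ∃ C b : ℝ, ∀ z, g z ≤ ENNReal.ofReal C * weight 1 b z := by
    obtain ⟨M, hM, k, hk⟩ := exists_norm_conv_le f (scale t θ)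
    refine ⟨M, k, fun z => ?_⟩
    change ‖conv f (scale t θ) z‖ₑ ≤ _
    rw [← ofReal_norm, weight, ← ENNReal.ofReal_mul hM, one_mul, Real.rpow_natCast]
    exact ENNReal.ofReal_le_ofReal (hk z)
  have hpe := peetre_rpow_le ht ha0 hr0 hr1 hKt hK0 hrep hgrowth
  have hav : Measurable (average t a r g) := by
    have : Measurable fun q : E d × E d => weight t (-(a * r)) (q.1 - q.2) * g q.2 ^ r :=
      ((measurable_weight _ _).comp (by fun_prop)).mul ((hgm.comp measurable_snd).pow_const r)
    exact this.lintegral_prod_right'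
  -- The majorant is the upper bound for the maximal function rather than that function itself: it
  -- is visibly measurable, and Young's inequality applies to it.
  refine ⟨fun x => (K a * average t a r g x) ^ r⁻¹, (hav.const_mul _).pow_const _, ?_,
    fun x => (ENNReal.le_rpow_inv_iff hr0).2 (hpe x)⟩
  have e1 : ∀ x, ((K a * average t a r g x) ^ r⁻¹) ^ p =
      K a ^ (p / r) * (∫⁻ y, weight t (-(a * r)) (x - y) * g y ^ r) ^ (p / r) := by
    intro x
    rw [← ENNReal.rpow_mul, ENNReal.mul_rpow_of_nonneg _ _ (by positivity), average,
      show r⁻¹ * p = p / r by ring]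
  simp_rw [e1]
  rw [lintegral_const_mul' _ _ (ENNReal.rpow_ne_top_of_nonneg (by positivity) (hKt a))]
  have e2 : ∀ y, (g y ^ r) ^ (p / r) = g y ^ p := fun y => by
    rw [← ENNReal.rpow_mul, mul_div_cancel₀ _ hr0.ne']
  have hY := lintegral_convolution_rpow_le (measurable_weight (d := d) t (-(a * r)))
    (hgm.pow_const r) hpr
  simp_rw [e2] at hY
  calc _ ≤ K a ^ (p / r) * ((∫⁻ y : E d, weight t (-(a * r)) y) ^ (p / r) * ∫⁻ y, g y ^ p) := by
        gcongr
    _ = (ENNReal.ofReal (C a) * (ENNReal.ofReal ((t : ℝ) ^ d) *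
          ∫⁻ y : E d, weight t (-(a * r)) y)) ^ (p / r) * ∫⁻ y, g y ^ p := by
        rw [← mul_assoc, ← ENNReal.mul_rpow_of_nonneg _ _ (by positivity), mul_assoc]
    _ = _ := by rw [ofReal_pow_mul_lintegral_weight ht]

/-- If the Fourier transforms of `θ μ` have no common zero on the compact set `K`, then every
convolution `f * ψ` with `ψ` frequency-localized in `t K` is dominated pointwise by one function
whose `L^p` norm is controlled by the pieces `f * (θ μ)_t`. -/
theorem exists_majorant {ι : Type*} [Fintype ι] (θ : ι → 𝓢(E d, ℂ))
    (hcs : ∀ μ, HasCompactSupport (𝓕 (θ μ) : 𝓢(E d, ℂ))) {K : Set (E d)}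
    (hK : IsCompact K) (hθ : ∀ ξ ∈ K, ∃ μ, 𝓕 (θ μ) ξ ≠ 0) {p a : ℝ} (hp : 0 < p)
    (ha : (d : ℝ) < a * min 1 p) :
    ∃ C : ℝ≥0∞, C ≠ ⊤ ∧ ∀ t : ℝˣ, 0 < (t : ℝ) → ∀ f : 𝓢'(E d, ℂ),
      ∃ V : E d → ℝ≥0∞, Measurable V ∧
        ∫⁻ x, V x ^ p ≤ C * ∑ μ, ∫⁻ x, ‖conv f (scale t (θ μ)) x‖ₑ ^ p ∧
        ∀ ψ : 𝓢(E d, ℂ), (∀ ξ, 𝓕 ψ ξ ≠ 0 → (t : ℝ)⁻¹ • ξ ∈ K) →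
          ∀ x, ‖conv f ψ x‖ₑ ≤ moment t a ψ * V x := by
  obtain ⟨ρ, hρ⟩ := exists_reproducing θ hK hθ
  choose C hC hV using fun μ => exists_peetre_majorant (θ μ) (hcs μ) hp ha
  have ha0 : 0 ≤ a := by
    by_contra! h
    have : a * min 1 p ≤ 0 := by
      have : 0 < min 1 p := lt_min one_pos hp
      nlinarith
    have : (0 : ℝ) ≤ d := Nat.cast_nonneg d
    linarith
  set c : ℝ≥0∞ := (Fintype.card ι : ℝ≥0∞) ^ p with hc
  have hct : c ≠ ⊤ := ENNReal.rpow_ne_top_of_nonneg hp.le (ENNReal.natCast_ne_top _)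
  have hmt : ∀ μ, moment 1 a (ρ μ) ^ p ≠ ⊤ := fun μ =>
    ENNReal.rpow_ne_top_of_nonneg hp.le (moment_one_ne_top _ _)
  refine ⟨c * ∑ μ, moment 1 a (ρ μ) ^ p * C μ, ENNReal.mul_ne_top hct
    (ENNReal.sum_ne_top.2 fun μ _ => ENNReal.mul_ne_top (hmt μ) (hC μ)), fun t ht f => ?_⟩
  choose V hVm hVp hVx using fun μ => hV μ t ht f
  refine ⟨fun x => ∑ μ, moment 1 a (ρ μ) * V μ x,
    Finset.measurable_sum _ fun μ _ => (hVm μ).const_mul _, ?_, ?_⟩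
  · calc ∫⁻ x, (∑ μ, moment 1 a (ρ μ) * V μ x) ^ p
        ≤ ∫⁻ x, c * ∑ μ, moment 1 a (ρ μ) ^ p * V μ x ^ p := by
          refine lintegral_mono fun x => (sum_rpow_le _ _ hp).trans (le_of_eq ?_)
          simp_rw [ENNReal.mul_rpow_of_nonneg _ _ hp.le]
          rfl
      _ = c * ∑ μ, moment 1 a (ρ μ) ^ p * ∫⁻ x, V μ x ^ p := by
          rw [lintegral_const_mul' _ _ hct, lintegral_finsetSum _
            fun μ _ => ((hVm μ).pow_const p).const_mul _]
          simp_rw [lintegral_const_mul' _ _ (hmt _)]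
      _ ≤ c * ∑ μ, moment 1 a (ρ μ) ^ p *
            (C μ * ∑ μ, ∫⁻ x, ‖conv f (scale t (θ μ)) x‖ₑ ^ p) := by
          gcongr with μ _
          refine (hVp μ).trans ?_
          gcongr
          exact Finset.single_le_sum (f := fun μ => ∫⁻ x, ‖conv f (scale t (θ μ)) x‖ₑ ^ p)
            (fun _ _ => zero_le) (Finset.mem_univ μ)
      _ = _ := by
          rw [mul_assoc, Finset.sum_mul]
          simp_rw [mul_assoc]
  · intro ψ hψ x
    rw [hρ t ψ hψ, conv_sum]
    refine (enorm_sum_le _ _).trans ?_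
    rw [← hρ t ψ hψ, Finset.mul_sum]
    refine Finset.sum_le_sum fun μ _ => ?_
    have h1 : ∀ w, ‖conv f (scale t (θ μ)) (x - w)‖ₑ ≤ V μ x * weight t a w := by
      intro w
      have h2 : ‖conv f (scale t (θ μ)) (x - w)‖ₑ * weight t (-a) w ≤ V μ x := by
        refine le_trans ?_ (hVx μ x)
        have := le_iSup (fun z => ‖conv f (scale t (θ μ)) z‖ₑ * weight t (-a) (x - z)) (x - w)
        rwa [sub_sub_cancel] at this
      calc ‖conv f (scale t (θ μ)) (x - w)‖ₑ
          = ‖conv f (scale t (θ μ)) (x - w)‖ₑ * weight t (-a) w * weight t a w := by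
            rw [mul_assoc, mul_comm (weight t (-a) w), weight_mul_neg ht.le, mul_one]
        _ ≤ _ := by gcongr
    -- Two iterations, first with ρ at scale t and then with ψ, evaluated at w = 0 where the weight
    -- is 1.
    have h3 := enorm_conv_sconv_sub_le ht.le ha0 f _ ψ
      (enorm_conv_sconv_sub_le ht.le ha0 f _ (scale t (ρ μ)) h1) 0
    rw [moment_scale t ht] at h3
    simpa [weight] using h3

end Majorant

/-! ### Frequency support and moments of shearlets -/

section Shearlet

variable {d : ℕ}

theorem actGL_apply (M : GL (Fin d) ℝ) (x : E d) (k : Fin d) :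
    actGL M x k = (M : Matrix (Fin d) (Fin d) ℝ).mulVec x k := rfl

theorem det_actGL (M : GL (Fin d) ℝ) :
    LinearMap.det ((actGL M : E d ≃L[ℝ] E d) : E d →ₗ[ℝ] E d) =
      (M : Matrix (Fin d) (Fin d) ℝ).det := by
  have : ((actGL M : E d ≃L[ℝ] E d) : E d →ₗ[ℝ] E d) =
      Matrix.toEuclideanLin (M : Matrix (Fin d) (Fin d) ℝ) := rfl
  rw [this, Matrix.toEuclideanLin_eq_toLin_orthonormal, LinearMap.det_toLin]

theorem actGL_inv (M : GL (Fin d) ℝ) : actGL M⁻¹ = (actGL M).symm := by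
  refine ContinuousLinearEquiv.ext (funext fun x => ?_)
  rw [ContinuousLinearEquiv.eq_symm_apply]
  ext k
  rw [actGL_apply]
  have : (actGL M⁻¹ x : Fin d → ℝ) = ((M⁻¹ : GL (Fin d) ℝ) : Matrix (Fin d) (Fin d) ℝ).mulVec x := rfl
  rw [this, Matrix.mulVec_mulVec, ← Units.val_mul, mul_inv_cancel, Units.val_one, Matrix.one_mulVec]

theorem dilate_apply (M : GL (Fin d) ℝ) (ψ : 𝓢(E d, ℂ)) (x : E d) :
    dilate M ψ x = (|(M : Matrix (Fin d) (Fin d) ℝ).det|⁻¹ : ℝ) • ψ (actGL M⁻¹ x) := rfl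

/-- The action of the transposed matrix. -/
def actTranspose (M : GL (Fin d) ℝ) (ξ : E d) : E d :=
  WithLp.toLp 2 ((M : Matrix (Fin d) (Fin d) ℝ).transpose.mulVec ξ)

theorem inner_actGL (M : GL (Fin d) ℝ) (x ξ : E d) :
    inner ℝ (actGL M x) ξ = inner ℝ x (actTranspose M ξ) := by
  rw [EuclideanSpace.inner_eq_star_dotProduct, EuclideanSpace.inner_eq_star_dotProduct]
  simp only [star_trivial]
  change (ξ : Fin d → ℝ) ⬝ᵥ (M : Matrix (Fin d) (Fin d) ℝ).mulVec x =
    (M : Matrix (Fin d) (Fin d) ℝ).transpose.mulVec ξ ⬝ᵥ x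
  rw [Matrix.dotProduct_mulVec, Matrix.mulVec_transpose]

theorem fourier_dilate (M : GL (Fin d) ℝ) (ψ : 𝓢(E d, ℂ)) (ξ : E d) :
    𝓕 (dilate M ψ) ξ = 𝓕 ψ (actTranspose M ξ) := by
  have h := fourier_comp_continuousLinearEquiv (actGL M⁻¹) (actTranspose M)
    (fun x ξ => by rw [actGL_inv, ContinuousLinearEquiv.symm_symm, inner_actGL]) ψ ξ
  rw [det_actGL] at h
  have h0 : 𝓕 (dilate M ψ) = (|(M : Matrix (Fin d) (Fin d) ℝ).det|⁻¹ : ℝ) •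
      𝓕 (SchwartzMap.compCLMOfContinuousLinearEquiv ℂ (actGL M⁻¹) ψ) := by
    rw [dilate, FourierTransform.fourier_smul]
  have h1 : 𝓕 (SchwartzMap.compCLMOfContinuousLinearEquiv ℂ (actGL M⁻¹) ψ) ξ =
      𝓕 (fun x => ψ (actGL M⁻¹ x)) ξ := rfl
  have hM : (M : Matrix (Fin d) (Fin d) ℝ).det ≠ 0 := M.det.ne_zero
  have hMi : ((M⁻¹ : GL (Fin d) ℝ) : Matrix (Fin d) (Fin d) ℝ).det =
      (M : Matrix (Fin d) (Fin d) ℝ).det⁻¹ := by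
    refine eq_inv_of_mul_eq_one_left ?_
    rw [← Matrix.det_mul, ← Units.val_mul, inv_mul_cancel, Units.val_one, Matrix.det_one]
  rw [h0, smul_apply, h1, h, hMi, abs_inv, inv_inv, Complex.real_smul, ← mul_assoc,
    ← Complex.ofReal_mul, inv_mul_cancel₀ (abs_ne_zero.2 hM), Complex.ofReal_one, one_mul]
  rfl

theorem tilde_apply (ψ : 𝓢(E d, ℂ)) (x : E d) : tilde ψ x = (starRingEnd ℂ) (ψ (-x)) := rfl

theorem fourier_tilde (ψ : 𝓢(E d, ℂ)) (ξ : E d) : 𝓕 (tilde ψ) ξ = (starRingEnd ℂ) (𝓕 ψ ξ) := by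
  change 𝓕 (tilde ψ : E d → ℂ) ξ = (starRingEnd ℂ) (𝓕 (ψ : E d → ℂ) ξ)
  rw [Real.fourier_eq', Real.fourier_eq', ← integral_conj,
    ← integral_neg_eq_self (fun v => Complex.exp ((↑(-2 * Real.pi * inner ℝ v ξ) * Complex.I)) •
      tilde ψ v) volume]
  refine integral_congr_ae (Filter.Eventually.of_forall fun v => ?_)
  simp only [tilde_apply, neg_neg, smul_eq_mul, map_mul, ← Complex.exp_conj, Complex.conj_ofReal,
    Complex.conj_I, inner_neg_left]
  congr 2
  push_cast
  ring

/-- The change of variables moves the matrix from the function to the weight, so moments of all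
dilates reduce to moments of one generator. -/
theorem lintegral_enorm_dilate_mul (M : GL (Fin d) ℝ) (ψ : 𝓢(E d, ℂ)) (w : E d → ℝ≥0∞) :
    ∫⁻ y, ‖dilate M ψ y‖ₑ * w y = ∫⁻ u, ‖ψ u‖ₑ * w (actGL M u) := by
  have hM : (M : Matrix (Fin d) (Fin d) ℝ).det ≠ 0 := M.det.ne_zero
  have hdet : LinearMap.det ((actGL M : E d ≃L[ℝ] E d) : E d →ₗ[ℝ] E d) ≠ 0 := by rwa [det_actGL]
  have hmap := Measure.map_linearMap_addHaar_eq_smul_addHaar (volume : Measure (E d)) hdet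
  rw [det_actGL] at hmap
  have h2 := ((actGL M).toHomeomorph.measurableEmbedding).lintegral_map
    (μ := (volume : Measure (E d))) (fun y => ‖ψ (actGL M⁻¹ y)‖ₑ * w y)
  have h3 : Measure.map (⇑(actGL M).toHomeomorph) (volume : Measure (E d)) =
      Measure.map (⇑((actGL M : E d ≃L[ℝ] E d) : E d →ₗ[ℝ] E d)) volume := rfl
  rw [h3, hmap, lintegral_smul_measure, smul_eq_mul,
    ← lintegral_const_mul' _ _ ENNReal.ofReal_ne_top] at h2
  calc ∫⁻ y, ‖dilate M ψ y‖ₑ * w y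
      = ∫⁻ y, ENNReal.ofReal |((M : Matrix (Fin d) (Fin d) ℝ).det)⁻¹| *
          (‖ψ (actGL M⁻¹ y)‖ₑ * w y) := by
        refine lintegral_congr fun y => ?_
        rw [dilate_apply, enorm_smul, Real.enorm_of_nonneg (by positivity), abs_inv, mul_assoc]
    _ = _ := h2
    _ = _ := by
        refine lintegral_congr fun u => ?_
        change ‖ψ (actGL M⁻¹ (actGL M u))‖ₑ * w (actGL M u) = _
        rw [actGL_inv, ContinuousLinearEquiv.symm_apply_apply]

/-- The shear parameter, extended by zero to the distinguished direction. -/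
def shearCoeff (i : Fin d) (ℓ : {k : Fin d // k ≠ i} → ℤ) (b : Fin d) : ℝ :=
  if h : b ≠ i then (ℓ ⟨b, h⟩ : ℝ) else 0

theorem shearCoeff_self (i : Fin d) (ℓ : {k : Fin d // k ≠ i} → ℤ) : shearCoeff i ℓ i = 0 := by
  simp [shearCoeff]

theorem abs_shearCoeff_le (i : Fin d) {ℓ : {k : Fin d // k ≠ i} → ℤ} {j : ℕ}
    (hℓ : ∀ k, |ℓ k| ≤ 2 ^ j) (b : Fin d) : |shearCoeff i ℓ b| ≤ 2 ^ j := by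
  unfold shearCoeff
  split_ifs with h
  · exact_mod_cast hℓ ⟨b, h⟩
  · simp

theorem coe_B (i : Fin d) (ℓ : {k : Fin d // k ≠ i} → ℤ) :
    (B i ℓ : Matrix (Fin d) (Fin d) ℝ) =
      1 + Matrix.of fun a b => if a = i then shearCoeff i ℓ b else 0 := by
  change 1 + shearPart i ℓ = _
  congr 1
  ext a b
  simp only [shearPart, shearCoeff, Matrix.of_apply]
  split_ifs <;> rfl

theorem coe_A_pow (i : Fin d) (j : ℕ) :
    ((A i ^ j : GL (Fin d) ℝ) : Matrix (Fin d) (Fin d) ℝ) =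
      Matrix.diagonal fun k => (if k = i then (4 : ℝ) else 2) ^ j := by
  rw [Units.val_pow_eq_pow_val]
  change (Matrix.diagonal fun k => if k = i then (4 : ℝ) else 2) ^ j = _
  rw [Matrix.diagonal_pow]; rfl

theorem coe_B_mul_A_pow_apply (i : Fin d) (ℓ : {k : Fin d // k ≠ i} → ℤ) (j : ℕ) (a b : Fin d) :
    ((B i ℓ * A i ^ j : GL (Fin d) ℝ) : Matrix (Fin d) (Fin d) ℝ) a b =
      ((if a = b then 1 else 0) + if a = i then shearCoeff i ℓ b else 0) *
        (if b = i then (4 : ℝ) else 2) ^ j := by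
  rw [Units.val_mul, coe_A_pow, Matrix.mul_diagonal, coe_B, Matrix.add_apply, Matrix.of_apply,
    Matrix.one_apply]

theorem actTranspose_B_mul_A_pow (i : Fin d) (ℓ : {k : Fin d // k ≠ i} → ℤ) (j : ℕ) (η : E d)
    (k : Fin d) : actTranspose (B i ℓ * A i ^ j) η k =
      (if k = i then (4 : ℝ) else 2) ^ j * (η k + shearCoeff i ℓ k * η i) := by
  change ∑ a, ((B i ℓ * A i ^ j : GL (Fin d) ℝ) : Matrix (Fin d) (Fin d) ℝ) a k * η a = _
  simp_rw [coe_B_mul_A_pow_apply, add_mul, Finset.sum_add_distrib, ite_mul, one_mul, zero_mul,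
    Finset.sum_ite_eq', Finset.mem_univ, if_true]
  split_ifs <;> ring

theorem actGL_B_mul_A_pow (i : Fin d) (ℓ : {k : Fin d // k ≠ i} → ℤ) (j : ℕ) (v : E d)
    (k : Fin d) : actGL (B i ℓ * A i ^ j) v k =
      (if k = i then (4 : ℝ) else 2) ^ j * v k +
        if k = i then ∑ b, shearCoeff i ℓ b * ((if b = i then (4 : ℝ) else 2) ^ j * v b) else 0 := by
  change ∑ b, ((B i ℓ * A i ^ j : GL (Fin d) ℝ) : Matrix (Fin d) (Fin d) ℝ) k b * v b = _
  simp_rw [coe_B_mul_A_pow_apply, add_mul, Finset.sum_add_distrib]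
  congr 1
  · simp_rw [ite_mul, one_mul, zero_mul]
    rw [Finset.sum_ite_eq, if_pos (Finset.mem_univ k)]
  · split_ifs
    · simp_rw [mul_assoc]
    · simp

theorem actTranspose_inv_actTranspose (M : GL (Fin d) ℝ) (ξ : E d) :
    actTranspose M⁻¹ (actTranspose M ξ) = ξ := by
  ext k
  change (((M⁻¹ : GL (Fin d) ℝ) : Matrix (Fin d) (Fin d) ℝ).transpose.mulVec
    ((M : Matrix (Fin d) (Fin d) ℝ).transpose.mulVec ξ)) k = ξ k
  rw [Matrix.mulVec_mulVec, ← Matrix.transpose_mul, ← Units.val_mul, mul_inv_cancel, Units.val_one,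
    Matrix.transpose_one, Matrix.one_mulVec]

/-- The shearlet with index `s`. -/
def shearlet (G : Generators d) (s : ShearIndex d) : 𝓢(E d, ℂ) :=
  dilate ((A s.1 ^ s.2.1)⁻¹ * (B s.1 s.2.2.1)⁻¹) (tilde (G.psi s.1))

theorem abs_apply_le_norm (ξ : E d) (k : Fin d) : |ξ k| ≤ ‖ξ‖ := PiLp.norm_apply_le ξ k

theorem norm_le_sum_abs (ξ : E d) : ‖ξ‖ ≤ ∑ k, |ξ k| := by
  rw [EuclideanSpace.norm_eq]
  refine Real.sqrt_le_iff.2 ⟨Finset.sum_nonneg fun _ _ => abs_nonneg _, ?_⟩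
  simp_rw [Real.norm_eq_abs]
  exact Finset.sum_sq_le_sq_sum_of_nonneg fun _ _ => abs_nonneg _

theorem fourier_psi (G : Generators d) (i : Fin d) (ξ : E d) : 𝓕 (G.psi i) ξ = G.psiHat i ξ := by
  rw [Generators.psi, FourierTransform.fourier_fourierInv_eq]; rfl

theorem psiHat_support (G : Generators d) {i : Fin d} {η : E d} (h : G.psiHat i η ≠ 0) :
    1 / 16 ≤ |η i| ∧ |η i| ≤ 1 / 2 ∧ ∀ k, |η k| ≤ |η i| := by
  have h1 : 1 / 16 ≤ |η i| := by
    by_contra! h'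
    exact h (by simp [Generators.psiHat, G.psi1Hat_eq_zero (Or.inl h')])
  refine ⟨h1, ?_, fun k => ?_⟩
  · by_contra! h'
    exact h (by simp [Generators.psiHat, G.psi1Hat_eq_zero (Or.inr h')])
  · rcases eq_or_ne k i with rfl | hk
    · exact le_rfl
    by_contra! h'
    have : G.psi2Hat (η k / η i) = 0 := by
      apply G.psi2Hat_eq_zero
      rw [abs_div, lt_div_iff₀ (by linarith), one_mul]
      exact h'
    refine h ?_
    rw [Generators.psiHat, Finset.prod_eq_zero (Finset.mem_erase.mpr ⟨hk, Finset.mem_univ k⟩) this,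
      mul_zero]

/-- If η is the pulled-back frequency, then ξ_i = 4^j η_i and ξ_k = 2^j (η_k + ℓ_k η_i) for k ≠ i.
With |η_k| ≤ |η_i| ≤ 1/2 and |ℓ_k| ≤ 2^j every coordinate is at most 4^j, while |η_i| ≥ 1/16 gives
the lower bound. -/
theorem fourier_shearlet_support (G : Generators d) (s : ShearIndex d) {ξ : E d}
    (h : 𝓕 (shearlet G s) ξ ≠ 0) :
    1 / 16 * 4 ^ s.2.1 ≤ ‖ξ‖ ∧ ‖ξ‖ ≤ d * 4 ^ s.2.1 := by
  obtain ⟨i, j, ℓ, hℓ⟩ := s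
  rw [shearlet, fourier_dilate, fourier_tilde] at h
  simp only at h ⊢
  set M := (A i ^ j)⁻¹ * (B i ℓ)⁻¹ with hM
  set η := actTranspose M ξ with hη
  have hne : G.psiHat i η ≠ 0 := by
    rw [← fourier_psi]
    exact fun h0 => h (by rw [h0, map_zero])
  obtain ⟨h1, h2, h3⟩ := psiHat_support G hne
  have hMi : M⁻¹ = B i ℓ * A i ^ j := by rw [hM, mul_inv_rev, inv_inv, inv_inv]
  have hξ : ξ = actTranspose (B i ℓ * A i ^ j) η := by
    rw [← hMi, hη, actTranspose_inv_actTranspose]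
  have hi : |ξ i| = 4 ^ j * |η i| := by
    rw [hξ, actTranspose_B_mul_A_pow, if_pos rfl, shearCoeff_self, zero_mul, add_zero, abs_mul,
      abs_of_nonneg (by positivity)]
  constructor
  · calc 1 / 16 * 4 ^ j ≤ |η i| * 4 ^ j := by gcongr
      _ = |ξ i| := by rw [hi, mul_comm]
      _ ≤ ‖ξ‖ := abs_apply_le_norm ξ i
  · have hk : ∀ k, |ξ k| ≤ 4 ^ j := by
      intro k
      rcases eq_or_ne k i with rfl | hki
      · rw [hi]
        have : (0 : ℝ) < 4 ^ j := by positivity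
        nlinarith
      · rw [hξ, actTranspose_B_mul_A_pow, if_neg hki, abs_mul, abs_of_nonneg (by positivity)]
        have h5 : |η k + shearCoeff i ℓ k * η i| ≤ 1 / 2 + 2 ^ j * (1 / 2) := by
          refine (abs_add_le _ _).trans (add_le_add ((h3 k).trans h2) ?_)
          rw [abs_mul]
          gcongr
          exact abs_shearCoeff_le i hℓ k
        have h6 : (1 : ℝ) ≤ 2 ^ j := one_le_pow₀ (by norm_num)
        have h7 : (4 : ℝ) ^ j = 2 ^ j * 2 ^ j := by rw [← mul_pow]; norm_num
        rw [h7]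
        gcongr
        linarith
    calc ‖ξ‖ ≤ ∑ k, |ξ k| := norm_le_sum_abs ξ
      _ ≤ ∑ _k : Fin d, (4 : ℝ) ^ j := Finset.sum_le_sum fun k _ => hk k
      _ = d * 4 ^ j := by simp

/-- For the image v of u, 4^j v_k = 2^j u_k when k ≠ i, and 4^j v_i = u_i - ∑ ℓ_b u_b. Both are
O(2^j ‖u‖) because |ℓ_b| ≤ 2^j. -/
theorem norm_actGL_le (i : Fin d) {ℓ : {k : Fin d // k ≠ i} → ℤ} {j : ℕ}
    (hℓ : ∀ k, |ℓ k| ≤ 2 ^ j) (u : E d) :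
    4 ^ j * ‖actGL ((A i ^ j)⁻¹ * (B i ℓ)⁻¹) u‖ ≤ (d * (1 + d)) * 2 ^ j * ‖u‖ := by
  set M := (A i ^ j)⁻¹ * (B i ℓ)⁻¹ with hM
  have hMi : M⁻¹ = B i ℓ * A i ^ j := by rw [hM, mul_inv_rev, inv_inv, inv_inv]
  set v := actGL M u with hv
  have hu : u = actGL (B i ℓ * A i ^ j) v := by
    rw [← hMi, hv, actGL_inv, ContinuousLinearEquiv.symm_apply_apply]
  have h6 : (1 : ℝ) ≤ 2 ^ j := one_le_pow₀ (by norm_num)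
  have h7 : (4 : ℝ) ^ j = 2 ^ j * 2 ^ j := by rw [← mul_pow]; norm_num
  have hk : ∀ k, k ≠ i → 2 ^ j * v k = u k := by
    intro k hki
    have := actGL_B_mul_A_pow i ℓ j v k
    rw [← hu, if_neg hki, if_neg hki, add_zero] at this
    exact this.symm
  have hi : 4 ^ j * v i = u i - ∑ b, shearCoeff i ℓ b * u b := by
    have := actGL_B_mul_A_pow i ℓ j v i
    rw [← hu, if_pos rfl, if_pos rfl] at this
    have e : ∑ b, shearCoeff i ℓ b * ((if b = i then (4 : ℝ) else 2) ^ j * v b) =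
        ∑ b, shearCoeff i ℓ b * u b := by
      refine Finset.sum_congr rfl fun b _ => ?_
      rcases eq_or_ne b i with rfl | hb
      · rw [shearCoeff_self, zero_mul, zero_mul]
      · rw [if_neg hb, hk b hb]
    rw [e] at this
    linarith
  have hd : (0 : ℝ) ≤ d := Nat.cast_nonneg d
  have hall : ∀ k, 4 ^ j * |v k| ≤ (1 + d) * 2 ^ j * ‖u‖ := by
    intro k
    rcases eq_or_ne k i with rfl | hki
    · have hs : |∑ b, shearCoeff k ℓ b * u b| ≤ d * (2 ^ j * ‖u‖) := by
        refine (Finset.abs_sum_le_sum_abs _ _).trans ?_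
        calc ∑ b, |shearCoeff k ℓ b * u b| ≤ ∑ _b : Fin d, 2 ^ j * ‖u‖ := by
              refine Finset.sum_le_sum fun b _ => ?_
              rw [abs_mul]
              exact mul_le_mul (abs_shearCoeff_le k hℓ b) (abs_apply_le_norm u b) (abs_nonneg _)
                (by positivity)
          _ = _ := by simp
      have : 4 ^ j * |v k| = |u k - ∑ b, shearCoeff k ℓ b * u b| := by
        rw [← hi, abs_mul, abs_of_nonneg (by positivity : (0 : ℝ) ≤ 4 ^ j)]
      rw [this]
      refine (abs_sub _ _).trans ?_
      have h8 := abs_apply_le_norm u k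
      have h9 : ‖u‖ ≤ 2 ^ j * ‖u‖ := le_mul_of_one_le_left (norm_nonneg _) h6
      nlinarith
    · have : 4 ^ j * |v k| = 2 ^ j * |u k| := by
        rw [← hk k hki, abs_mul, abs_of_nonneg (by positivity : (0 : ℝ) ≤ 2 ^ j), h7, mul_assoc]
      rw [this, mul_assoc]
      have h8 : 2 ^ j * |u k| ≤ 2 ^ j * ‖u‖ := by gcongr; exact abs_apply_le_norm u k
      have h9 : 0 ≤ d * (2 ^ j * ‖u‖) := by positivity
      linarith
  calc 4 ^ j * ‖v‖ ≤ 4 ^ j * ∑ k, |v k| := by gcongr; exact norm_le_sum_abs v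
    _ = ∑ k, 4 ^ j * |v k| := Finset.mul_sum _ _ _
    _ ≤ ∑ _k : Fin d, (1 + d) * 2 ^ j * ‖u‖ := Finset.sum_le_sum fun k _ => hall k
    _ = _ := by simp; ring

theorem exists_moment_shearlet_le (G : Generators d) {a : ℝ} (ha : 0 ≤ a) :
    ∃ C : ℝ≥0∞, C ≠ ⊤ ∧ ∀ s : ShearIndex d,
      moment (4 ^ s.2.1) a (shearlet G s) ≤ C * ENNReal.ofReal ((2 : ℝ) ^ ((s.2.1 : ℝ) * a)) := by
  set D : ℝ := 1 + d * (1 + d) with hD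
  have hD1 : 1 ≤ D := by
    have : (0 : ℝ) ≤ d * (1 + d) := by positivity
    linarith
  refine ⟨ENNReal.ofReal (D ^ a) * ∑ i, moment 1 a (tilde (G.psi i)),
    ENNReal.mul_ne_top ENNReal.ofReal_ne_top
      (ENNReal.sum_ne_top.2 fun i _ => moment_one_ne_top _ _), ?_⟩
  rintro ⟨i, j, ℓ, hℓ⟩
  simp only
  rw [moment, shearlet, lintegral_enorm_dilate_mul]
  have hw : ∀ u : E d, weight (4 ^ j) a (actGL ((A i ^ j)⁻¹ * (B i ℓ)⁻¹) u) ≤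
      (ENNReal.ofReal (D ^ a) * ENNReal.ofReal ((2 : ℝ) ^ ((j : ℝ) * a))) * weight 1 a u := by
    intro u
    have h6 : (1 : ℝ) ≤ 2 ^ j := one_le_pow₀ (by norm_num)
    have hb : 0 < 1 + 1 * ‖u‖ := base_pos zero_le_one u
    rw [weight, weight, Real.rpow_mul (by norm_num), Real.rpow_natCast,
      ← ENNReal.ofReal_mul (by positivity), ← Real.mul_rpow (by positivity) (by positivity),
      ← ENNReal.ofReal_mul (by positivity), ← Real.mul_rpow (by positivity) hb.le]
    refine ENNReal.ofReal_le_ofReal (Real.rpow_le_rpow (by positivity) ?_ ha)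
    have h1 := norm_actGL_le i hℓ u
    have h2 : (1 : ℝ) ≤ D * 2 ^ j := one_le_mul_of_one_le_of_one_le hD1 h6
    have h3 : d * (1 + d) * 2 ^ j * ‖u‖ ≤ D * 2 ^ j * ‖u‖ := by
      gcongr
      linarith
    linarith
  calc _ ≤ ∫⁻ u, (ENNReal.ofReal (D ^ a) * ENNReal.ofReal ((2 : ℝ) ^ ((j : ℝ) * a))) *
          (‖tilde (G.psi i) u‖ₑ * weight 1 a u) := by
        refine lintegral_mono fun u => ?_
        rw [mul_left_comm]
        exact mul_le_mul_right (hw u) _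
    _ = (ENNReal.ofReal (D ^ a) * ENNReal.ofReal ((2 : ℝ) ^ ((j : ℝ) * a))) *
          moment 1 a (tilde (G.psi i)) := by
        rw [lintegral_const_mul' _ _ (ENNReal.mul_ne_top ENNReal.ofReal_ne_top
          ENNReal.ofReal_ne_top)]; rfl
    _ ≤ (ENNReal.ofReal (D ^ a) * ENNReal.ofReal ((2 : ℝ) ^ ((j : ℝ) * a))) *
          ∑ i, moment 1 a (tilde (G.psi i)) := by
        gcongr
        exact Finset.single_le_sum (f := fun i => moment 1 a (tilde (G.psi i)))
          (fun _ _ => zero_le) (Finset.mem_univ i)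
    _ = _ := by ring

end Shearlet

/-! ### Powers of two -/

section TwoPow

/-- Real powers of two, as extended nonnegative reals. -/
def twoPow (x : ℝ) : ℝ≥0∞ := ENNReal.ofReal ((2 : ℝ) ^ x)

theorem twoPow_add (x y : ℝ) : twoPow (x + y) = twoPow x * twoPow y := by
  rw [twoPow, Real.rpow_add two_pos, ENNReal.ofReal_mul (by positivity)]; rfl

theorem twoPow_zero : twoPow 0 = 1 := by simp [twoPow]

theorem twoPow_ne_top (x : ℝ) : twoPow x ≠ ⊤ := ENNReal.ofReal_ne_top

theorem twoPow_mono {x y : ℝ} (h : x ≤ y) : twoPow x ≤ twoPow y :=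
  ENNReal.ofReal_le_ofReal (Real.rpow_le_rpow_of_exponent_le one_le_two h)

theorem twoPow_le_one {x : ℝ} (h : x ≤ 0) : twoPow x ≤ 1 := by
  rw [← twoPow_zero]; exact twoPow_mono h

theorem twoPow_rpow (x : ℝ) {r : ℝ} (hr : 0 ≤ r) : twoPow x ^ r = twoPow (x * r) := by
  rw [twoPow, ENNReal.ofReal_rpow_of_nonneg (by positivity) hr, ← Real.rpow_mul two_pos.le]; rfl

theorem twoPow_natCast (n : ℕ) : twoPow n = 2 ^ n := by
  rw [twoPow, Real.rpow_natCast, ENNReal.ofReal_pow two_pos.le]; simp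

theorem tsum_twoPow_ne_top {δ : ℝ} (hδ : 0 < δ) : ∑' j : ℕ, twoPow (-((j : ℝ) * δ)) ≠ ⊤ := by
  have h : ∀ j : ℕ, twoPow (-((j : ℝ) * δ)) = twoPow (-δ) ^ j := by
    intro j
    rw [← ENNReal.rpow_natCast, twoPow_rpow _ (Nat.cast_nonneg j)]
    congr 1; ring
  simp_rw [h]
  rw [ENNReal.tsum_geometric]
  refine ENNReal.inv_ne_top.2 (tsub_pos_of_lt ?_).ne'
  rw [twoPow, ENNReal.ofReal_lt_one]
  exact Real.rpow_lt_one_of_one_lt_of_neg one_lt_two (by linarith)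

end TwoPow

/-! ### The sequence norms -/

section EllNorm

theorem le_ellNorm {ι : Type*} {q : ℝ≥0∞} (hq : 0 < q) (a : ι → ℝ≥0∞) (i : ι) :
    a i ≤ ellNorm q a := by
  unfold ellNorm
  split_ifs with h
  · exact le_iSup a i
  · have hq' : 0 < q.toReal := ENNReal.toReal_pos hq.ne' h
    rw [one_div, ENNReal.le_rpow_inv_iff hq']
    exact ENNReal.le_tsum (f := fun i => a i ^ q.toReal) i

theorem card_shear {d : ℕ} (i : Fin d) (j : ℕ) (c : ℝ≥0∞) :
    ∑' _ : {ℓ : {k : Fin d // k ≠ i} → ℤ // ∀ k, |ℓ k| ≤ 2 ^ j}, c =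
      ((2 * 2 ^ j + 1 : ℕ) : ℝ≥0∞) ^ (d - 1) * c := by
  have hmem : ∀ ℓ : {k : Fin d // k ≠ i} → ℤ, (∀ k, |ℓ k| ≤ 2 ^ j) ↔
      ℓ ∈ Fintype.piFinset fun _ : {k : Fin d // k ≠ i} => Finset.Icc (-(2 : ℤ) ^ j) (2 ^ j) := by
    intro ℓ
    simp only [Fintype.mem_piFinset, Finset.mem_Icc, abs_le]
  rw [← (Equiv.subtypeEquivRight hmem).symm.tsum_eq (fun _ => c), tsum_fintype,
    Finset.sum_const, Finset.card_univ, Fintype.card_coe, Fintype.card_piFinset, Finset.prod_const, Finset.card_univ, Int.card_Icc, nsmul_eq_mul]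
  have h1 : ((2 : ℤ) ^ j + 1 - -2 ^ j).toNat = 2 * 2 ^ j + 1 := by
    rw [show (2 : ℤ) ^ j + 1 - -2 ^ j = ((2 * 2 ^ j + 1 : ℕ) : ℤ) by push_cast; ring, Int.toNat_natCast]
  have h2 : Fintype.card {k : Fin d // k ≠ i} = d - 1 := by
    rw [Fintype.card_subtype_compl, Fintype.card_fin, Fintype.card_subtype_eq]
  rw [h1, h2, Nat.cast_pow]

/-- Scale j carries at most 3^{d-1} 2^{j(d-1)} shears per direction. The decay 2^{-j(d-1)/q} pays
for their number, and ε leaves a geometric series in j. -/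
theorem exists_ellNorm_shear_le {d : ℕ} {q : ℝ≥0∞} (hq : 0 < q) {ε : ℝ} (hε : 0 < ε) :
    ∃ C : ℝ≥0∞, C ≠ ⊤ ∧ ∀ (w : ShearIndex d → ℝ≥0∞) (S : ℝ≥0∞),
      (∀ s, w s ≤ twoPow (-((s.2.1 : ℝ) * (((d : ℝ) - 1) * (q⁻¹).toReal + ε))) * S) →
        ellNorm q w ≤ C * S := by
  -- For d = 0 the index set is empty; otherwise the truncated difference d - 1 agrees with the real
  -- one.
  rcases Nat.eq_zero_or_pos d with rfl | hd
  · refine ⟨1, ENNReal.one_ne_top, fun w S _ => ?_⟩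
    have : IsEmpty (ShearIndex 0) := ⟨fun s => s.1.elim0⟩
    have hz : ellNorm q w = 0 := by
      unfold ellNorm
      split_ifs with h
      · simp
      · simp [ENNReal.toReal_pos hq.ne' h]
    rw [hz]; exact zero_le
  have hd1 : (0 : ℝ) ≤ (d : ℝ) - 1 := by
    have : (1 : ℝ) ≤ d := by exact_mod_cast hd
    linarith
  -- Here 1/q reads as 0 and a supremum needs no counting.
  by_cases h : q = ⊤
  · subst h
    refine ⟨1, ENNReal.one_ne_top, fun w S hw => ?_⟩
    rw [ellNorm, if_pos rfl]
    refine iSup_le fun s => (hw s).trans ?_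
    gcongr
    refine twoPow_le_one ?_
    have : 0 ≤ (s.2.1 : ℝ) * (((d : ℝ) - 1) * ((⊤ : ℝ≥0∞)⁻¹).toReal + ε) := by positivity
    linarith
  have hQ : 0 < q.toReal := ENNReal.toReal_pos hq.ne' h
  set Q := q.toReal with hQdef
  set Z : ℝ≥0∞ := ∑' j : ℕ, twoPow (-((j : ℝ) * (ε * Q))) with hZ
  have hZt : Z ≠ ⊤ := tsum_twoPow_ne_top (mul_pos hε hQ)
  refine ⟨(d * (3 ^ (d - 1) * Z)) ^ (1 / Q), ENNReal.rpow_ne_top_of_nonneg (by positivity)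
    (ENNReal.mul_ne_top (ENNReal.natCast_ne_top _) (ENNReal.mul_ne_top
      (ENNReal.pow_ne_top (by norm_num)) hZt)), fun w S hw => ?_⟩
  rw [ellNorm, if_neg h]
  have hterm : ∀ s : ShearIndex d,
      w s ^ Q ≤ twoPow (-((s.2.1 : ℝ) * ((d : ℝ) - 1 + ε * Q))) * S ^ Q := by
    intro s
    calc w s ^ Q ≤ (twoPow (-((s.2.1 : ℝ) * (((d : ℝ) - 1) * (q⁻¹).toReal + ε))) * S) ^ Q := by
          gcongr; exact hw s
      _ = _ := by
          rw [ENNReal.mul_rpow_of_nonneg _ _ hQ.le, twoPow_rpow _ hQ.le]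
          congr 2
          rw [ENNReal.toReal_inv, ← hQdef]
          field_simp
  have hj : ∀ j : ℕ, ((2 * 2 ^ j + 1 : ℕ) : ℝ≥0∞) ^ (d - 1) *
      (twoPow (-((j : ℝ) * ((d : ℝ) - 1 + ε * Q))) * S ^ Q) ≤
        3 ^ (d - 1) * (twoPow (-((j : ℝ) * (ε * Q))) * S ^ Q) := by
    intro j
    have h1 : ((2 * 2 ^ j + 1 : ℕ) : ℝ≥0∞) ≤ 3 * twoPow j := by
      rw [twoPow_natCast]
      have : 2 * 2 ^ j + 1 ≤ 3 * 2 ^ j := by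
        have := Nat.one_le_two_pow (n := j); omega
      exact_mod_cast this
    have h2 : twoPow j ^ (d - 1) * twoPow (-((j : ℝ) * ((d : ℝ) - 1 + ε * Q))) =
        twoPow (-((j : ℝ) * (ε * Q))) := by
      rw [← ENNReal.rpow_natCast, twoPow_rpow _ (Nat.cast_nonneg _), ← twoPow_add,
        Nat.cast_sub hd, Nat.cast_one]
      congr 1; ring
    calc _ ≤ (3 * twoPow j) ^ (d - 1) *
          (twoPow (-((j : ℝ) * ((d : ℝ) - 1 + ε * Q))) * S ^ Q) := by gcongr
      _ = 3 ^ (d - 1) * ((twoPow j ^ (d - 1) *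
          twoPow (-((j : ℝ) * ((d : ℝ) - 1 + ε * Q)))) * S ^ Q) := by rw [mul_pow]; ring
      _ = _ := by rw [h2]
  have hsum : ∑' s, w s ^ Q ≤ (d * (3 ^ (d - 1) * Z)) * S ^ Q := by
    calc ∑' s, w s ^ Q
        ≤ ∑' s : ShearIndex d, twoPow (-((s.2.1 : ℝ) * ((d : ℝ) - 1 + ε * Q))) * S ^ Q :=
          ENNReal.tsum_le_tsum hterm
      _ = ∑' i : Fin d, ∑' j : ℕ, ((2 * 2 ^ j + 1 : ℕ) : ℝ≥0∞) ^ (d - 1) *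
            (twoPow (-((j : ℝ) * ((d : ℝ) - 1 + ε * Q))) * S ^ Q) := by
          rw [ENNReal.tsum_sigma']
          refine tsum_congr fun i => ?_
          rw [ENNReal.tsum_sigma']
          exact tsum_congr fun j => card_shear i j (twoPow (-((j : ℝ) * ((d : ℝ) - 1 + ε * Q))) * S ^ Q)
      _ ≤ ∑' _ : Fin d, ∑' j : ℕ, 3 ^ (d - 1) * (twoPow (-((j : ℝ) * (ε * Q))) * S ^ Q) :=
          ENNReal.tsum_le_tsum fun i => ENNReal.tsum_le_tsum hj
      _ = _ := by
          rw [tsum_fintype, Finset.sum_const, Finset.card_univ, Fintype.card_fin, nsmul_eq_mul,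
            ENNReal.tsum_mul_left, ENNReal.tsum_mul_right]
          ring
  calc (∑' s, w s ^ Q) ^ (1 / Q) ≤ ((d * (3 ^ (d - 1) * Z)) * S ^ Q) ^ (1 / Q) := by gcongr
    _ = _ := by
      rw [ENNReal.mul_rpow_of_nonneg _ _ (by positivity), ← ENNReal.rpow_mul,
        mul_one_div_cancel hQ.ne', ENNReal.rpow_one]

end EllNorm

/-! ### Bounds for the Littlewood–Paley pieces -/

section Pieces

variable {d : ℕ}

theorem eLpNorm_rpow_toReal {F : Type*} [TopologicalSpace F] [ContinuousENorm F] (g : E d → F)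
    {p : ℝ≥0∞} (hp : 0 < p) (hp_top : p < ⊤) :
    eLpNorm g p volume ^ p.toReal = ∫⁻ x, ‖g x‖ₑ ^ p.toReal := by
  have h : 0 < p.toReal := ENNReal.toReal_pos hp.ne' hp_top.ne
  rw [eLpNorm_eq_lintegral_rpow_enorm_toReal hp.ne' hp_top.ne, ← ENNReal.rpow_mul,
    one_div_mul_cancel h.ne', ENNReal.rpow_one]

theorem lintegral_conv_Phi_le (φ Φ : 𝓢(E d, ℂ)) (α : ℝ) (q : ℝ≥0∞) {p : ℝ≥0∞} (hp : 0 < p)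
    (hp_top : p < ⊤) (f : 𝓢'(E d, ℂ)) :
    ∫⁻ x, ‖conv f Φ x‖ₑ ^ p.toReal ≤ normF φ Φ α q p f ^ p.toReal := by
  rw [← eLpNorm_rpow_toReal _ hp hp_top]
  gcongr
  exact le_self_add

/-- A single term is at most the whole ℓ^q norm. -/
theorem lintegral_conv_dyadicDilate_le (φ Φ : 𝓢(E d, ℂ)) (α : ℝ) {q p : ℝ≥0∞} (hq : 0 < q)
    (hp : 0 < p) (hp_top : p < ⊤) (f : 𝓢'(E d, ℂ)) (ν : ℕ) :
    ∫⁻ x, ‖conv f (dyadicDilate ν φ) x‖ₑ ^ p.toReal ≤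
      twoPow (-((ν : ℝ) * α * p.toReal)) * normF φ Φ α q p f ^ p.toReal := by
  have hP : 0 < p.toReal := ENNReal.toReal_pos hp.ne' hp_top.ne
  have h1 : twoPow ((ν : ℝ) * α * p.toReal) * ∫⁻ x, ‖conv f (dyadicDilate ν φ) x‖ₑ ^ p.toReal ≤
      normF φ Φ α q p f ^ p.toReal := by
    calc _ = ∫⁻ x, (twoPow ((ν : ℝ) * α) * ‖conv f (dyadicDilate ν φ) x‖ₑ) ^ p.toReal := by
          rw [← lintegral_const_mul' _ _ (twoPow_ne_top _)]
          refine lintegral_congr fun x => ?_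
          rw [ENNReal.mul_rpow_of_nonneg _ _ hP.le, twoPow_rpow _ hP.le]
      _ ≤ ∫⁻ x, ‖ellNorm q fun ν : ℕ => ENNReal.ofReal ((2 : ℝ) ^ ((ν : ℝ) * α)) *
            ‖conv f (dyadicDilate ν φ) x‖ₑ‖ₑ ^ p.toReal := by
          refine lintegral_mono fun x => ?_
          simp only [enorm_eq_self]
          gcongr
          exact le_ellNorm hq (fun ν : ℕ => ENNReal.ofReal ((2 : ℝ) ^ ((ν : ℝ) * α)) *
            ‖conv f (dyadicDilate ν φ) x‖ₑ) ν
      _ = _ := (eLpNorm_rpow_toReal _ hp hp_top).symm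
      _ ≤ _ := by
          gcongr
          exact le_add_self
  calc _ = twoPow (-((ν : ℝ) * α * p.toReal)) * (twoPow ((ν : ℝ) * α * p.toReal) *
        ∫⁻ x, ‖conv f (dyadicDilate ν φ) x‖ₑ ^ p.toReal) := by
        rw [← mul_assoc, ← twoPow_add, neg_add_cancel, twoPow_zero, one_mul]
    _ ≤ _ := by gcongr

/-- Take the least ν with x ≤ (5/3) 2^ν. Minimality gives x > (5/6) 2^ν, and 5/6 ≥ 3/5: consecutive
dyadic annuli overlap. -/
theorem exists_dyadic_index {x : ℝ} (hx : 5 / 3 < x) {N : ℕ} (hN : x ≤ 5 / 3 * 2 ^ N) :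
    ∃ ν ≤ N, 3 / 5 ≤ (2 ^ ν)⁻¹ * x ∧ (2 ^ ν)⁻¹ * x ≤ 5 / 3 := by
  classical
  have hex : ∃ ν : ℕ, x ≤ 5 / 3 * 2 ^ ν := ⟨N, hN⟩
  have h1 := Nat.find_spec hex
  have hle := Nat.find_min' hex hN
  set ν := Nat.find hex with hν
  have h0 : ν ≠ 0 := by
    intro h0
    rw [h0] at h1
    norm_num at h1
    linarith
  obtain ⟨m, hm⟩ := Nat.exists_eq_succ_of_ne_zero h0
  have h2 : ¬ x ≤ 5 / 3 * 2 ^ m := Nat.find_min hex (by omega)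
  have hpos : (0 : ℝ) < 2 ^ ν := by positivity
  refine ⟨ν, hle, ?_, ?_⟩
  · rw [inv_mul_eq_div, le_div_iff₀ hpos, hm, pow_succ]
    rw [not_le] at h2
    have : (0 : ℝ) < 2 ^ m := by positivity
    linarith
  · rw [inv_mul_eq_div, div_le_iff₀ hpos]
    exact h1

theorem hasCompactSupport_fourier_of_norm_le {θ : 𝓢(E d, ℂ)} {R : ℝ}
    (h : tsupport (𝓕 θ : 𝓢(E d, ℂ)) ⊆ {ξ | ‖ξ‖ ≤ R}) : HasCompactSupport (𝓕 θ : 𝓢(E d, ℂ)) :=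
  HasCompactSupport.of_support_subset_isCompact (isCompact_closedBall (0 : E d) R)
    fun _ hξ => mem_closedBall_zero_iff.2 (h (subset_tsupport _ hξ))

theorem hasCompactSupport_fourier_scale (t : ℝˣ) {θ : 𝓢(E d, ℂ)}
    (h : HasCompactSupport (𝓕 θ : 𝓢(E d, ℂ))) : HasCompactSupport (𝓕 (scale t θ) : 𝓢(E d, ℂ)) := by
  have : ((𝓕 (scale t θ) : 𝓢(E d, ℂ)) : E d → ℂ) =
      (𝓕 θ : 𝓢(E d, ℂ)) ∘ (Homeomorph.smulOfNeZero (t : ℝ)⁻¹ (inv_ne_zero t.ne_zero)) :=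
    funext fun ξ => fourier_scale t θ ξ
  rw [this]
  exact h.comp_homeomorph _

/-- The unit `2`. -/
def twoUnit : ℝˣ := Units.mk0 (2 : ℝ) two_ne_zero

theorem coe_twoUnit_pow (n : ℕ) : ((twoUnit ^ n : ℝˣ) : ℝ) = 2 ^ n := by
  rw [Units.val_pow_eq_pow_val]; rfl

end Pieces

/-! ### Majorants of the shearlet coefficients -/

section Main

variable {d : ℕ} {φ Φ : 𝓢(E d, ℂ)}

theorem fourier_scale_ne_zero (h : IsDyadicPair φ Φ) (t : ℝˣ) {ξ : E d}
    (h1 : 3 / 5 ≤ ‖(t : ℝ)⁻¹ • ξ‖) (h2 : ‖(t : ℝ)⁻¹ • ξ‖ ≤ 5 / 3) : 𝓕 (scale t φ) ξ ≠ 0 := by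
  obtain ⟨c, hc, hle⟩ := h.lower_phi
  rw [fourier_scale]
  exact norm_pos_iff.1 (hc.trans_le (hle _ h1 h2))

theorem hasCompactSupport_fourier_phi (h : IsDyadicPair φ Φ) :
    HasCompactSupport (𝓕 φ : 𝓢(E d, ℂ)) :=
  hasCompactSupport_fourier_of_norm_le (h.supp_phi.trans fun _ hξ => hξ.2)

/-- On the ball of radius R, Φ covers |ξ| ≤ 5/3 and finitely many dilates of φ cover the rest. This
handles Ψ and the first few shearlet scales. -/
theorem exists_low_majorant (h : IsDyadicPair φ Φ) (α : ℝ) {q p : ℝ≥0∞} (hq : 0 < q) (hp : 0 < p)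
    (hp_top : p < ⊤) {a : ℝ} (ha : (d : ℝ) < a * min 1 p.toReal) (R : ℝ) :
    ∃ C : ℝ≥0∞, C ≠ ⊤ ∧ ∀ f : 𝓢'(E d, ℂ), ∃ V : E d → ℝ≥0∞, Measurable V ∧
      ∫⁻ x, V x ^ p.toReal ≤ C * normF φ Φ α q p f ^ p.toReal ∧
      ∀ ψ : 𝓢(E d, ℂ), (∀ ξ, 𝓕 ψ ξ ≠ 0 → ‖ξ‖ ≤ R) →
        ∀ x, ‖conv f ψ x‖ₑ ≤ moment 1 a ψ * V x := by
  have hP : 0 < p.toReal := ENNReal.toReal_pos hp.ne' hp_top.ne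
  obtain ⟨N, hN⟩ := pow_unbounded_of_one_lt (R * (3 / 5)) (one_lt_two (α := ℝ))
  let θ : Option (Fin (N + 1)) → 𝓢(E d, ℂ) := fun o => o.elim Φ fun ν => scale (twoUnit ^ (ν : ℕ)) φ
  have hcs : ∀ o, HasCompactSupport (𝓕 (θ o) : 𝓢(E d, ℂ)) := by
    rintro (_ | ν)
    · exact hasCompactSupport_fourier_of_norm_le h.supp_Phi
    · exact hasCompactSupport_fourier_scale _ (hasCompactSupport_fourier_phi h)
  have hne : ∀ ξ ∈ Metric.closedBall (0 : E d) R, ∃ o, 𝓕 (θ o) ξ ≠ 0 := by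
    intro ξ hξ
    rw [mem_closedBall_zero_iff] at hξ
    by_cases hξ1 : ‖ξ‖ ≤ 5 / 3
    · obtain ⟨c, hc, hle⟩ := h.lower_Phi
      exact ⟨none, norm_pos_iff.1 (hc.trans_le (hle ξ hξ1))⟩
    · obtain ⟨ν, hν, h1, h2⟩ := exists_dyadic_index (not_le.1 hξ1) (N := N) (by linarith)
      have e : ‖((twoUnit ^ ν : ℝˣ) : ℝ)⁻¹ • ξ‖ = (2 ^ ν)⁻¹ * ‖ξ‖ := by
        rw [norm_smul, coe_twoUnit_pow, Real.norm_of_nonneg (by positivity)]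
      exact ⟨some ⟨ν, by omega⟩, fourier_scale_ne_zero h _ (by rwa [e]) (by rwa [e])⟩
  obtain ⟨C, hC, hmaj⟩ := exists_majorant θ hcs (isCompact_closedBall (0 : E d) R) hne hP ha
  refine ⟨C * (1 + ∑ ν : Fin (N + 1), twoPow (-((ν : ℕ) * α * p.toReal))), ENNReal.mul_ne_top hC
    (ENNReal.add_ne_top.2 ⟨ENNReal.one_ne_top, ENNReal.sum_ne_top.2 fun _ _ => twoPow_ne_top _⟩),
    fun f => ?_⟩
  obtain ⟨V, hVm, hVp, hVx⟩ := hmaj 1 (by simp) f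
  refine ⟨V, hVm, hVp.trans ?_, fun ψ hψ x => ?_⟩
  · rw [mul_assoc, Fintype.sum_option, add_mul, one_mul, Finset.sum_mul]
    simp only [scale_one]
    gcongr with ν _
    · exact lintegral_conv_Phi_le φ Φ α q hp hp_top f
    · have := lintegral_conv_dyadicDilate_le φ Φ α hq hp hp_top f ν
      rwa [dyadicDilate_eq_scale] at this
  · have := hVx ψ (fun ξ hξ => by simpa using hψ ξ hξ) x
    simpa using this

theorem exists_high_majorant (h : IsDyadicPair φ Φ) (α : ℝ) {q p : ℝ≥0∞} (hq : 0 < q) (hp : 0 < p)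
    (hp_top : p < ⊤) {a : ℝ} (ha : (d : ℝ) < a * min 1 p.toReal) (R : ℝ) :
    ∃ C : ℝ≥0∞, C ≠ ⊤ ∧ ∀ (f : 𝓢'(E d, ℂ)) (j : ℕ), 3 ≤ j → ∃ V : E d → ℝ≥0∞, Measurable V ∧
      ∫⁻ x, V x ^ p.toReal ≤
        C * (twoPow (-(2 * j * α * p.toReal)) * normF φ Φ α q p f ^ p.toReal) ∧
      ∀ ψ : 𝓢(E d, ℂ), (∀ ξ, 𝓕 ψ ξ ≠ 0 → 1 / 16 * 4 ^ j ≤ ‖ξ‖ ∧ ‖ξ‖ ≤ R * 4 ^ j) →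
        ∀ x, ‖conv f ψ x‖ₑ ≤ moment (4 ^ j) a ψ * V x := by
  have hP : 0 < p.toReal := ENNReal.toReal_pos hp.ne' hp_top.ne
  obtain ⟨N, hN⟩ := pow_unbounded_of_one_lt (32 * R * (3 / 5)) (one_lt_two (α := ℝ))
  -- The shift by 2^{-5} gives 32 · (1/16) = 2 > 5/3, as the choice of a dyadic index requires. At
  -- scale 4^j the dilation exponent becomes 2j - 5 + ν, which is nonnegative because j ≥ 3.
  let θ : Fin (N + 1) → 𝓢(E d, ℂ) := fun ν => scale (twoUnit ^ (ν : ℕ) * (twoUnit ^ 5)⁻¹) φ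
  have hcs : ∀ o, HasCompactSupport (𝓕 (θ o) : 𝓢(E d, ℂ)) := fun ν =>
    hasCompactSupport_fourier_scale _ (hasCompactSupport_fourier_phi h)
  have hK : IsCompact ({ξ : E d | 1 / 16 ≤ ‖ξ‖} ∩ Metric.closedBall (0 : E d) R) :=
    (isCompact_closedBall _ _).inter_left (isClosed_le continuous_const continuous_norm)
  have hne : ∀ ξ ∈ {ξ : E d | 1 / 16 ≤ ‖ξ‖} ∩ Metric.closedBall (0 : E d) R,
      ∃ o, 𝓕 (θ o) ξ ≠ 0 := by
    rintro ξ ⟨hξ1, hξ2⟩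
    rw [mem_closedBall_zero_iff] at hξ2
    have hξ3 : 1 / 16 ≤ ‖ξ‖ := hξ1
    obtain ⟨ν, hν, h1, h2⟩ := exists_dyadic_index (x := 32 * ‖ξ‖) (by linarith) (N := N)
      (by linarith)
    have e : ‖((twoUnit ^ ν * (twoUnit ^ 5)⁻¹ : ℝˣ) : ℝ)⁻¹ • ξ‖ = (2 ^ ν)⁻¹ * (32 * ‖ξ‖) := by
      rw [norm_smul, Units.val_mul, Units.val_inv_eq_inv_val, coe_twoUnit_pow, coe_twoUnit_pow,
        mul_inv, inv_inv, Real.norm_of_nonneg (by positivity)]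
      norm_num [mul_assoc]
    exact ⟨⟨ν, by omega⟩, fourier_scale_ne_zero h _ (by rwa [e]) (by rwa [e])⟩
  obtain ⟨C, hC, hmaj⟩ := exists_majorant θ hcs hK hne hP ha
  -- These factors convert the decay at level 2j - 5 + ν into the decay at level 2j.
  refine ⟨C * ∑ ν : Fin (N + 1), twoPow ((5 - (ν : ℕ)) * α * p.toReal), ENNReal.mul_ne_top hC
    (ENNReal.sum_ne_top.2 fun _ _ => twoPow_ne_top _), fun f j hj => ?_⟩
  have ht : ((twoUnit ^ (2 * j) : ℝˣ) : ℝ) = 4 ^ j := by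
    rw [coe_twoUnit_pow, pow_mul]; norm_num
  obtain ⟨V, hVm, hVp, hVx⟩ := hmaj (twoUnit ^ (2 * j)) (by rw [ht]; positivity) f
  refine ⟨V, hVm, hVp.trans ?_, fun ψ hψ x => ?_⟩
  · rw [mul_assoc, Finset.sum_mul]
    gcongr with ν _
    obtain ⟨n, hn⟩ : ∃ n, 2 * j = n + 5 := ⟨2 * j - 5, by omega⟩
    have e : scale (twoUnit ^ (2 * j)) (θ ν) = dyadicDilate (n + ν) φ := by
      rw [scale_scale, dyadicDilate_eq_scale]
      congr 1
      change _ = twoUnit ^ (n + (ν : ℕ))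
      rw [hn, pow_add, pow_add, mul_comm (twoUnit ^ (ν : ℕ)), mul_assoc, mul_inv_cancel_left]
    rw [e, ← mul_assoc, ← twoPow_add]
    refine (lintegral_conv_dyadicDilate_le φ Φ α hq hp hp_top f (n + ν)).trans (le_of_eq ?_)
    congr 2
    have hn' : 2 * (j : ℝ) = n + 5 := by exact_mod_cast hn
    rw [hn']
    push_cast
    ring
  · rw [← ht]
    refine hVx ψ (fun ξ hξ => ?_) x
    obtain ⟨h1, h2⟩ := hψ ξ hξ
    have h4 : (0 : ℝ) < 4 ^ j := by positivity
    have e : ‖((4 : ℝ) ^ j)⁻¹ • ξ‖ = ‖ξ‖ / 4 ^ j := by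
      rw [norm_smul, Real.norm_of_nonneg (by positivity), inv_mul_eq_div]
    rw [ht]
    refine ⟨?_, ?_⟩
    · change 1 / 16 ≤ ‖((4 : ℝ) ^ j)⁻¹ • ξ‖
      rwa [e, le_div_iff₀ h4]
    · rw [mem_closedBall_zero_iff, e, div_le_iff₀ h4]
      exact h2

theorem moment_mono {s t : ℝ} (hs : 0 ≤ s) (hst : s ≤ t) {a : ℝ} (ha : 0 ≤ a) (ψ : 𝓢(E d, ℂ)) :
    moment s a ψ ≤ moment t a ψ := by
  unfold moment weight
  gcongr with y

theorem exists_shearlet_majorant (h : IsDyadicPair φ Φ) (G : Generators d) (α : ℝ) {q p : ℝ≥0∞}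
    (hq : 0 < q) (hp : 0 < p) (hp_top : p < ⊤) {a : ℝ} (ha0 : 0 ≤ a)
    (ha : (d : ℝ) < a * min 1 p.toReal) :
    ∃ C : ℝ≥0∞, C ≠ ⊤ ∧ ∀ f : 𝓢'(E d, ℂ), ∃ W : ℕ → E d → ℝ≥0∞, (∀ j, Measurable (W j)) ∧
      (∀ j : ℕ, ∫⁻ x, W j x ^ p.toReal ≤
        C * (twoPow (-(2 * j * α * p.toReal)) * normF φ Φ α q p f ^ p.toReal)) ∧
      (∀ s x, ‖conv f (shearlet G s) x‖ₑ ≤ twoPow ((s.2.1 : ℝ) * a) * W s.2.1 x) ∧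
      ∀ x, ‖conv f G.Psi x‖ₑ ≤ W 0 x := by
  have hP : 0 < p.toReal := ENNReal.toReal_pos hp.ne' hp_top.ne
  -- For j ≤ 2 one has 4^j ≤ 16, so a ball of radius 16d contains the frequencies of these
  -- shearlets, and those of Ψ as well.
  obtain ⟨CL, hCL, hlow⟩ := exists_low_majorant h α hq hp hp_top ha (d * 16)
  obtain ⟨CH, hCH, hhigh⟩ := exists_high_majorant h α hq hp hp_top ha d
  obtain ⟨CM, hCM, hmom⟩ := exists_moment_shearlet_le G ha0
  -- Adding the moment of Ψ lets W 0 also dominate the low-frequency term.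
  set D : ℝ≥0∞ := CM + moment 1 a G.Psi with hD
  have hDt : D ≠ ⊤ := ENNReal.add_ne_top.2 ⟨hCM, moment_one_ne_top _ _⟩
  set CL' : ℝ≥0∞ := CL * ∑ j ∈ Finset.range 3, twoPow (2 * j * α * p.toReal) with hCL'
  have hCLt : CL' ≠ ⊤ := ENNReal.mul_ne_top hCL (ENNReal.sum_ne_top.2 fun _ _ => twoPow_ne_top _)
  refine ⟨D ^ p.toReal * (CL' + CH), ENNReal.mul_ne_top (ENNReal.rpow_ne_top_of_nonneg hP.le hDt)
    (ENNReal.add_ne_top.2 ⟨hCLt, hCH⟩), fun f => ?_⟩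
  obtain ⟨VL, hLm, hLp, hLx⟩ := hlow f
  choose! VH hHm hHp hHx using hhigh f
  let V : ℕ → E d → ℝ≥0∞ := fun j => if j < 3 then VL else VH j
  set F := normF φ Φ α q p f ^ p.toReal with hF
  have hVp : ∀ j : ℕ, ∫⁻ x, V j x ^ p.toReal ≤
      (CL' + CH) * (twoPow (-(2 * j * α * p.toReal)) * F) := by
    intro j
    by_cases hj : j < 3
    · simp only [V, if_pos hj]
      calc _ ≤ CL * F := hLp
        _ = CL * twoPow (2 * j * α * p.toReal) * (twoPow (-(2 * j * α * p.toReal)) * F) := by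
            rw [mul_assoc, ← mul_assoc (twoPow _), ← twoPow_add, add_neg_cancel, twoPow_zero,
              one_mul]
        _ ≤ (CL' + CH) * (twoPow (-(2 * j * α * p.toReal)) * F) := by
            gcongr
            refine le_trans ?_ le_self_add
            rw [hCL']
            gcongr
            exact Finset.single_le_sum (f := fun j : ℕ => twoPow (2 * j * α * p.toReal))
              (fun _ _ => zero_le) (Finset.mem_range.2 hj)
    · simp only [V, if_neg hj]
      refine (hHp j (by omega)).trans ?_
      gcongr
      exact le_add_self
  have hVx : ∀ s x, ‖conv f (shearlet G s) x‖ₑ ≤ moment (4 ^ s.2.1) a (shearlet G s) * V s.2.1 x := by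
    intro s x
    have hsupp := fun ξ => fourier_shearlet_support G s (ξ := ξ)
    have h1 : (1 : ℝ) ≤ 4 ^ s.2.1 := one_le_pow₀ (by norm_num)
    by_cases hj : s.2.1 < 3
    · simp only [V, if_pos hj]
      refine (hLx (shearlet G s) (fun ξ hξ => ?_) x).trans ?_
      · refine (hsupp ξ hξ).2.trans ?_
        gcongr
        calc (4 : ℝ) ^ s.2.1 ≤ 4 ^ 2 := pow_le_pow_right₀ (by norm_num) (by omega)
          _ = 16 := by norm_num
      · gcongr
        exact moment_mono zero_le_one h1 ha0 _
    · simp only [V, if_neg hj]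
      exact hHx s.2.1 (by omega) (shearlet G s) hsupp x
  refine ⟨fun j x => D * V j x, fun j => ?_, fun j => ?_, fun s x => ?_, fun x => ?_⟩
  · refine Measurable.const_mul ?_ _
    by_cases hj : j < 3
    · simpa only [V, if_pos hj] using hLm
    · simpa only [V, if_neg hj] using hHm j (by omega)
  · simp_rw [ENNReal.mul_rpow_of_nonneg _ _ hP.le]
    rw [lintegral_const_mul' _ _ (ENNReal.rpow_ne_top_of_nonneg hP.le hDt), mul_assoc]
    gcongr
    exact hVp j
  · calc _ ≤ moment (4 ^ s.2.1) a (shearlet G s) * V s.2.1 x := hVx s x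
      _ ≤ (D * twoPow ((s.2.1 : ℝ) * a)) * V s.2.1 x := by
          gcongr
          refine (hmom s).trans ?_
          change CM * twoPow _ ≤ _
          gcongr
          exact le_self_add
      _ = _ := by ring
  · refine (hLx G.Psi (fun ξ hξ => ?_) x).trans ?_
    · have hk : ∀ k, |ξ k| ≤ 1 / 4 := G.supp_Psi (subset_tsupport _ hξ)
      calc ‖ξ‖ ≤ ∑ k, |ξ k| := norm_le_sum_abs ξ
        _ ≤ ∑ _k : Fin d, (16 : ℝ) := Finset.sum_le_sum fun k _ => (hk k).trans (by norm_num)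
        _ = d * 16 := by simp
    · simp only [V, Nat.ofNat_pos, if_true]
      gcongr
      exact le_add_self

/-! ### Summation over scales and shears. -/

theorem ofReal_cellVolume_rpow (d j : ℕ) (α : ℝ) :
    ENNReal.ofReal (cellVolume d j ^ (-α)) = twoPow ((j : ℝ) * (((d : ℝ) + 1) * α)) := by
  rw [cellVolume, twoPow, Real.inv_rpow (by positivity), ← Real.rpow_neg (by positivity), neg_neg,
    ← Real.rpow_natCast, ← Real.rpow_mul two_pos.le]
  congr 2
  push_cast
  ring

theorem exists_normFAB_le (h : IsDyadicPair φ Φ) (G : Generators d) {α₁ α₂ lam : ℝ} {q p : ℝ≥0∞}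
    (hq : 0 < q) (hp : 0 < p) (hp_top : p < ⊤)
    (hlam : (d : ℝ) * max 1 (p⁻¹).toReal < lam)
    (hα : ((d : ℝ) + 1) * α₂ + ((d : ℝ) - 1) * (q⁻¹).toReal + lam ≤ 2 * α₁) :
    ∃ C : ℝ≥0∞, C ≠ ⊤ ∧ ∀ f, normFAB G α₂ q p f ≤ C * normF φ Φ α₁ q p f := by
  have hP : 0 < p.toReal := ENNReal.toReal_pos hp.ne' hp_top.ne
  set P := p.toReal with hPdef
  obtain ⟨a, ha1, ha2⟩ := exists_between hlam
  have hd : (0 : ℝ) ≤ d := Nat.cast_nonneg d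
  have ha0 : 0 ≤ a := le_trans (by positivity) ha1.le
  have ha : (d : ℝ) < a * min 1 P := by
    rw [ENNReal.toReal_inv, ← hPdef] at ha1
    have hmin : 0 < min 1 P := lt_min one_pos hP
    have hone : 1 ≤ max 1 P⁻¹ * min 1 P := by
      rcases le_total 1 P with h1 | h1
      · rw [min_eq_left h1, mul_one]; exact le_max_left _ _
      · rw [min_eq_right h1]
        calc (1 : ℝ) = P⁻¹ * P := (inv_mul_cancel₀ hP.ne').symm
          _ ≤ _ := by gcongr; exact le_max_right _ _
    calc (d : ℝ) ≤ d * (max 1 P⁻¹ * min 1 P) := le_mul_of_one_le_right hd hone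
      _ = (d * max 1 P⁻¹) * min 1 P := by ring
      _ < _ := by gcongr
  -- The gap is split in two: one ε for the ℓ^q sum over indices, one for the sum over j of L^p
  -- norms.
  set ε : ℝ := (lam - a) / 2 with hε
  have hε0 : 0 < ε := by rw [hε]; linarith
  obtain ⟨C, hC, hW⟩ := exists_shearlet_majorant h G α₁ hq hp hp_top ha0 ha
  obtain ⟨CQ, hCQ, hQ⟩ := exists_ellNorm_shear_le (d := d) hq hε0
  set Z : ℝ≥0∞ := ∑' j : ℕ, twoPow (-((j : ℝ) * (ε * P))) with hZ
  have hZt : Z ≠ ⊤ := tsum_twoPow_ne_top (mul_pos hε0 hP)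
  refine ⟨C ^ (1 / P) + CQ * (C * Z) ^ (1 / P), ENNReal.add_ne_top.2
    ⟨ENNReal.rpow_ne_top_of_nonneg (by positivity) hC, ENNReal.mul_ne_top hCQ
      (ENNReal.rpow_ne_top_of_nonneg (by positivity) (ENNReal.mul_ne_top hC hZt))⟩, fun f => ?_⟩
  obtain ⟨W, hWm, hWp, hWs, hW0⟩ := hW f
  set F := normF φ Φ α₁ q p f with hF
  have hroot : ∀ c : ℝ≥0∞, (c * F ^ P) ^ (1 / P) = c ^ (1 / P) * F := fun c => by
    rw [ENNReal.mul_rpow_of_nonneg _ _ (by positivity), ← ENNReal.rpow_mul,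
      mul_one_div_cancel hP.ne', ENNReal.rpow_one]
  rw [normFAB, add_mul]
  refine add_le_add ?_ ?_
  · rw [eLpNorm_eq_lintegral_rpow_enorm_toReal hp.ne' hp_top.ne, ← hroot]
    gcongr ?_ ^ (1 / P)
    calc ∫⁻ x, ‖conv f G.Psi x‖ₑ ^ P ≤ ∫⁻ x, W 0 x ^ P := by
          gcongr with x; exact hW0 x
      _ ≤ _ := by simpa [twoPow_zero] using hWp 0
  -- This supremum is independent of the shearlet index, so the ℓ^q norm acts on pure powers of 2
  -- only.
  · let S : E d → ℝ≥0∞ := fun x => ⨆ j : ℕ, twoPow ((j : ℝ) * (2 * α₁ - ε)) * W j x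
    have hS : ∀ x, (ellNorm q fun s : ShearIndex d =>
        ENNReal.ofReal (cellVolume d s.2.1 ^ (-α₂)) * ‖conv f (shearlet G s) x‖ₑ) ≤ CQ * S x := by
      intro x
      refine hQ _ _ fun s => ?_
      set j := s.2.1 with hj
      rw [ofReal_cellVolume_rpow]
      calc twoPow ((j : ℝ) * (((d : ℝ) + 1) * α₂)) * ‖conv f (shearlet G s) x‖ₑ
          ≤ twoPow ((j : ℝ) * (((d : ℝ) + 1) * α₂)) * (twoPow ((j : ℝ) * a) * W j x) := by
            gcongr; exact hWs s x
        _ = twoPow ((j : ℝ) * (((d : ℝ) + 1) * α₂ + a)) * W j x := by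
            rw [← mul_assoc, ← twoPow_add]; congr 2; ring
        _ ≤ twoPow (-((j : ℝ) * (((d : ℝ) - 1) * (q⁻¹).toReal + ε)) +
              (j : ℝ) * (2 * α₁ - ε)) * W j x := by
            gcongr
            refine twoPow_mono ?_
            have : ((d : ℝ) + 1) * α₂ + a ≤
                -(((d : ℝ) - 1) * (q⁻¹).toReal + ε) + (2 * α₁ - ε) := by
              have : ε + ε = lam - a := by rw [hε]; ring
              linarith
            calc _ ≤ (j : ℝ) * (-(((d : ℝ) - 1) * (q⁻¹).toReal + ε) + (2 * α₁ - ε)) := by gcongr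
              _ = _ := by ring
        _ ≤ _ := by
            rw [twoPow_add, mul_assoc]
            gcongr
            exact le_iSup (fun j : ℕ => twoPow ((j : ℝ) * (2 * α₁ - ε)) * W j x) j
    have hSP : ∫⁻ x, S x ^ P ≤ (C * Z) * F ^ P := by
      -- The P-th power of a supremum is at most the sum of the P-th powers, for every P > 0, so the
      -- scales separate.
      calc ∫⁻ x, S x ^ P ≤ ∫⁻ x, ∑' j : ℕ, (twoPow ((j : ℝ) * (2 * α₁ - ε)) * W j x) ^ P := by
            refine lintegral_mono fun x => ?_
            rw [← ENNReal.le_rpow_inv_iff hP]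
            refine iSup_le fun j => ?_
            rw [ENNReal.le_rpow_inv_iff hP]
            exact ENNReal.le_tsum (f := fun j : ℕ => (twoPow ((j : ℝ) * (2 * α₁ - ε)) * W j x) ^ P) j
        _ = ∑' j : ℕ, ∫⁻ x, (twoPow ((j : ℝ) * (2 * α₁ - ε)) * W j x) ^ P :=
            lintegral_tsum fun j => (((hWm j).const_mul _).pow_const P).aemeasurable
        _ ≤ ∑' j : ℕ, (C * F ^ P) * twoPow (-((j : ℝ) * (ε * P))) := by
            refine ENNReal.tsum_le_tsum fun j => ?_
            simp_rw [ENNReal.mul_rpow_of_nonneg _ _ hP.le, twoPow_rpow _ hP.le]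
            rw [lintegral_const_mul' _ _ (twoPow_ne_top _)]
            calc _ ≤ twoPow ((j : ℝ) * (2 * α₁ - ε) * P) *
                  (C * (twoPow (-(2 * j * α₁ * P)) * F ^ P)) := by gcongr; exact hWp j
              _ = (C * F ^ P) * (twoPow ((j : ℝ) * (2 * α₁ - ε) * P) *
                  twoPow (-(2 * j * α₁ * P))) := by ring
              _ = _ := by rw [← twoPow_add]; congr 2; ring
        _ = _ := by rw [ENNReal.tsum_mul_left]; ring
    rw [eLpNorm_eq_lintegral_rpow_enorm_toReal hp.ne' hp_top.ne, mul_assoc, ← hroot]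
    calc _ ≤ (∫⁻ x, (CQ * S x) ^ P) ^ (1 / P) := by
          gcongr with x
          rw [enorm_eq_self]
          exact hS x
      _ = CQ * (∫⁻ x, S x ^ P) ^ (1 / P) := by
          simp_rw [ENNReal.mul_rpow_of_nonneg _ _ hP.le]
          rw [lintegral_const_mul' _ _ (ENNReal.rpow_ne_top_of_nonneg hP.le hCQ),
            ENNReal.mul_rpow_of_nonneg _ _ (by positivity), ← ENNReal.rpow_mul,
            mul_one_div_cancel hP.ne', ENNReal.rpow_one]
      _ ≤ _ := by gcongr

end Main

end ShearTL

end

theorem mainTheorem7 (d : ℕ) (hd : 1 ≤ d) (α₁ α₂ lam : ℝ) (p q : ℝ≥0∞)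
    (hp : 0 < p) (hp_top : p < ⊤) (hq : 0 < q)
    (hlam : (d : ℝ) * max 1 (max (q⁻¹).toReal (p⁻¹).toReal) < lam)
    (hα : ((d : ℝ) + 1) * α₂ + ((d : ℝ) - 1) * (q⁻¹).toReal + lam ≤ 2 * α₁)
    (φ Φ : 𝓢(ShearTL.E d, ℂ)) (hφΦ : ShearTL.IsDyadicPair φ Φ) (G : ShearTL.Generators d) :
    ShearTL.spaceF φ Φ α₁ q p ⊆ ShearTL.spaceFAB G α₂ q p ∧
      ∃ C : ℝ≥0, ∀ f ∈ ShearTL.spaceF φ Φ α₁ q p,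
        ShearTL.normFAB G α₂ q p f ≤ C * ShearTL.normF φ Φ α₁ q p f := by
  have hlam' : (d : ℝ) * max 1 (p⁻¹).toReal < lam := by
    refine lt_of_le_of_lt ?_ hlam
    gcongr
    exact le_max_right _ _
  obtain ⟨C, hC, hle⟩ := ShearTL.exists_normFAB_le hφΦ G hq hp hp_top hlam' hα
  refine ⟨fun f hf => ?_, C.toNNReal, fun f _ => ?_⟩
  · exact (hle f).trans_lt (ENNReal.mul_lt_top hC.lt_top hf)
  · rw [ENNReal.coe_toNNReal hC]
    exact hle f
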